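/- For a finite graph $G$ on a vertex set $V$, a box representation of $G$ of dimension $d$ is a family of interval graphs $I_1,\dots,I_d$ on $V$, each given by nonempty closed real intervals $[l_i(v),r_i(v)]$, $v\in V$, such that $E(G)=E(I_1)\cap\dots\cap E(I_d)$ (for $d=0$ the intersection is the edge set of the complete graph on $V$). The boxicity $\operatorname{box}(G)$ is the minimum dimension of a box representation of $G$ (so it is $0$ for complete graphs), and a box representation of dimension $\operatorname{box}(G)$ is called optimal. **Theorem.** Let $G$ be a graph on $n$ vertices containing a clique of size $n-k$ or more. Then $\operatorname{box}(G)\le k$, and an optimal box representation of $G$ can be found in time $n^2\,2^{O(k^2\log k)}$. That is, there are one program for the unit-cost random access machine (operations: addition, truncated subtraction, zero test, indirect addressing, on natural numbers) and one constant $C$ such that for every $n\ge 1$ and every graph $G$ on the vertices $0,\dots,n-1$, given by $n$ and its adjacency matrix, the program halts with $\operatorname{box}(G)$ and the end points of the intervals of an optimal box representation of $G$ as output, and for every $k\ge 0$ such that $G$ contains a clique of size at least $n-k$ its number of steps is at most $C\,n^2\,2^{C k^2\log_2 k}$ (where $k^2\log_2 k$ is read as $0$ for $k=0$). -/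

import Mathlib

namespace Boxicity

/-! ### Interval graphs, box representations, boxicity -/

/-- The intersection graph of the closed real intervals `[l v, r v]`, `v ∈ V`. -/
def intervalGraph {V : Type*} (l r : V → ℝ) : SimpleGraph V where
  Adj u v := u ≠ v ∧ (Set.Icc (l u) (r u) ∩ Set.Icc (l v) (r v)).Nonempty
  symm := ⟨fun _ _ h => ⟨h.1.symm, by rw [Set.inter_comm]; exact h.2⟩⟩
  loopless := ⟨fun _ h => h.1 rfl⟩

/-- The (nonempty) intervals `[l i v, r i v]`, `i < d`, form a box representation of `G` of
dimension `d`: the edge set of `G` is the intersection of the edge sets of the `d` interval graphs.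
For `d = 0` the empty intersection is the complete graph. -/
def IsBoxRep {V : Type*} (G : SimpleGraph V) (d : ℕ) (l r : Fin d → V → ℝ) : Prop :=
  (∀ i v, l i v ≤ r i v) ∧ G = ⨅ i, intervalGraph (l i) (r i)

/-- The boxicity of `G`: the least dimension of a box representation (`⊤` if there is none). -/
noncomputable def boxicity {V : Type*} (G : SimpleGraph V) : ℕ∞ :=
  sInf {d : ℕ∞ | ∃ m : ℕ, d = m ∧ ∃ l r : Fin m → V → ℝ, IsBoxRep G m l r}

/-! ### Unit-cost random access machine

Programs are structured (sequence, conditional, while loop). The store consists of registers and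
arrays, all holding natural numbers; a program mentions finitely many of them by name, and array
cells are addressed by computed values. The arithmetic is addition and truncated subtraction
only (no multiplication), and every elementary operation costs one step. -/

/-- The store of the machine: registers and arrays, named by natural numbers. -/
structure Store where
  /-- content of a register -/
  reg : ℕ → ℕ
  /-- content of a cell of an array -/
  arr : ℕ → ℕ → ℕ

/-- Arithmetic expressions; `get a e` is the cell of the array `a` whose index is the value
of `e`. -/
inductive RExpr : Type
  | const (c : ℕ)
  | reg (x : ℕ)
  | get (a : ℕ) (e : RExpr)
  | add (e₁ e₂ : RExpr)
  | sub (e₁ e₂ : RExpr)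

/-- The value of an expression in a store. -/
def RExpr.eval (s : Store) : RExpr → ℕ
  | .const c => c
  | .reg x => s.reg x
  | .get a e => s.arr a (e.eval s)
  | .add e₁ e₂ => e₁.eval s + e₂.eval s
  | .sub e₁ e₂ => e₁.eval s - e₂.eval s

/-- The number of elementary operations in the evaluation of an expression. -/
def RExpr.cost : RExpr → ℕ
  | .const _ => 1
  | .reg _ => 1
  | .get _ e => e.cost + 1
  | .add e₁ e₂ => e₁.cost + e₂.cost + 1
  | .sub e₁ e₂ => e₁.cost + e₂.cost + 1

/-- Programs. A test `e` succeeds if the value of `e` is nonzero. -/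
inductive Prog : Type
  | skip
  | set (x : ℕ) (e : RExpr)
  | put (a : ℕ) (i e : RExpr)
  | seq (p q : Prog)
  | ite (e : RExpr) (p q : Prog)
  | loop (e : RExpr) (p : Prog)

/-- Assign a value to a register. -/
def Store.setReg (s : Store) (x v : ℕ) : Store :=
  { s with reg := Function.update s.reg x v }

/-- Assign a value to an array cell. -/
def Store.setArr (s : Store) (a i v : ℕ) : Store :=
  { s with arr := Function.update s.arr a (Function.update (s.arr a) i v) }

/-- `Run p s t s'`: started in the store `s`, the program `p` halts after exactly `t` steps in the
store `s'`. -/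
inductive Run : Prog → Store → ℕ → Store → Prop
  | skip (s : Store) : Run .skip s 1 s
  | set (s : Store) (x : ℕ) (e : RExpr) :
      Run (.set x e) s (e.cost + 1) (s.setReg x (e.eval s))
  | put (s : Store) (a : ℕ) (i e : RExpr) :
      Run (.put a i e) s (i.cost + e.cost + 1) (s.setArr a (i.eval s) (e.eval s))
  | seq {p q : Prog} {s s' s'' : Store} {t t' : ℕ} :
      Run p s t s' → Run q s' t' s'' → Run (.seq p q) s (t + t') s''
  | ite_true {e : RExpr} {p q : Prog} {s s' : Store} {t : ℕ} :
      e.eval s ≠ 0 → Run p s t s' → Run (.ite e p q) s (e.cost + 1 + t) s'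
  | ite_false {e : RExpr} {p q : Prog} {s s' : Store} {t : ℕ} :
      e.eval s = 0 → Run q s t s' → Run (.ite e p q) s (e.cost + 1 + t) s'
  | loop_true {e : RExpr} {p : Prog} {s s' s'' : Store} {t t' : ℕ} :
      e.eval s ≠ 0 → Run p s t s' → Run (.loop e p) s' t' s'' →
        Run (.loop e p) s (e.cost + 1 + t + t') s''
  | loop_false {e : RExpr} {p : Prog} {s : Store} :
      e.eval s = 0 → Run (.loop e p) s (e.cost + 1) s

/-! ### Input and output -/

open Classical in
/-- The input store for a graph on the vertices `0, …, n - 1`: register `0` holds `n`, array `0`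
holds the adjacency matrix row by row, and everything else is `0`. -/
noncomputable def inputStore {n : ℕ} (G : SimpleGraph (Fin n)) : Store where
  reg x := if x = 0 then n else 0
  arr a m := if a = 0 ∧ ∃ u v : Fin n, G.Adj u v ∧ m = (u : ℕ) * n + v then 1 else 0

/-- The store holds an optimal box representation of `G`: register `0` holds `box G`, and, for
`i < box G`, the interval of the vertex `v` in the `i`-th interval graph has its left and right end
points in the cell `i * n + v` of the arrays `1` and `2`. -/
def HoldsOptimalBoxRep {n : ℕ} (G : SimpleGraph (Fin n)) (s : Store) : Prop :=
  (s.reg 0 : ℕ∞) = boxicity G ∧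
    IsBoxRep G (s.reg 0)
      (fun i v => (s.arr 1 ((i : ℕ) * n + v) : ℝ)) (fun i v => (s.arr 2 ((i : ℕ) * n + v) : ℝ))

end Boxicity

/-!
The complement of a maximal matching of the complement of `G` is a clique. Every clique misses at
least half of the set `A` of matched vertices, so `|A| ≤ 2 k` whenever `G` has a clique of size
`n - k`. One interval graph for each vertex outside a clique suffices to represent `G`.

In each dimension of a box representation, the intervals of the clique `Aᶜ` have a common point, and
each of them may be shrunk to the least interval that contains this point and meets the intervals of
its neighbours in `A`. Only the order of this point and the end points of the intervals of `A`
matters, so all of them may be taken to be numbers up to `4 |A|`. This leaves at most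
`(4 |A| + 1) ^ (2 d |A|)` candidates for a representation of dimension `d ≤ |A|`, each of them the
sequence of digits of a number; they are tried one after another, in increasing dimension.

The algorithm is written in a language with bounded sums and loops only, each of which has at most
`n` rounds or at most `W` rounds, where `W` depends on `|A|` only. The running time is then read
off the syntax: it is `O(n ^ a * W ^ b)`, where `a` and `b` are the nesting depths of sums and loops
of the two kinds.
-/

namespace Boxicity

/-! ### A language of loop programs -/

/-- The two quantities that bound the numbers of rounds of loops and of summands of sums: the number
`n` of vertices, and a number `W` of trials. They matter for the running time only. -/
inductive Extent : Type
  | vertices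
  | trials

instance : DecidableEq Extent
  | .vertices, .vertices | .trials, .trials => isTrue rfl
  | .vertices, .trials | .trials, .vertices => isFalse nofun

/-- The value of an extent for `n` vertices and `W` trials. -/
def Extent.eval (n W : ℕ) : Extent → ℕ
  | vertices => n
  | trials => W

/-- Terms over the registers and arrays of a store; `sum b x e f` is the sum of the values of `f`,
where the register `x` runs through the numbers below the value of `e`. -/
inductive Term : Type
  | const (c : ℕ)
  | var (x : ℕ)
  | get (a : ℕ) (e : Term)
  | add (e f : Term)
  | sub (e f : Term)
  | sum (b : Extent) (x : ℕ) (e f : Term)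

/-- Commands; `loop b x e p` executes `p` for all values of the register `x` below the value
that `e` has at the start. -/
inductive Cmd : Type
  | set (x : ℕ) (e : Term)
  | put (a : ℕ) (i e : Term)
  | seq (p q : Cmd)
  | loop (b : Extent) (x : ℕ) (e : Term) (p : Cmd)

namespace Term

/-- The value of a term in a store. -/
def eval : Term → Store → ℕ
  | const c, _ => c
  | var x, s => s.reg x
  | get a e, s => s.arr a (e.eval s)
  | add e f, s => e.eval s + f.eval s
  | sub e f, s => e.eval s - f.eval s
  | sum _ x e f, s => ∑ i ∈ Finset.range (e.eval s), f.eval (s.setReg x i)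

/-- Free variables are below `k`, and sums bind the variables `k`, `k + 1`, … in their order
of nesting. -/
def inScope : Term → ℕ → Bool
  | const _, _ => true
  | var x, k => decide (x < k)
  | get _ e, k => e.inScope k
  | add e f, k => e.inScope k && f.inScope k
  | sub e f, k => e.inScope k && f.inScope k
  | sum _ x e f, k => decide (x = k) && e.inScope k && f.inScope (k + 1)

/-- All sums have at most as many summands as their extents promise. -/
def Fits (n W : ℕ) : Term → Store → Prop
  | const _, _ => True
  | var _, _ => True
  | get _ e, s => e.Fits n W s
  | add e f, s => e.Fits n W s ∧ f.Fits n W s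
  | sub e f, s => e.Fits n W s ∧ f.Fits n W s
  | sum b x e f, s => e.Fits n W s ∧ e.eval s ≤ b.eval n W ∧
      ∀ i < e.eval s, f.Fits n W (s.setReg x i)

end Term

/-- The store after `i` rounds of a loop with body `f` and counter `x`. -/
def Store.rounds (f : Store → Store) (x : ℕ) (s : Store) : ℕ → Store
  | 0 => s
  | i + 1 => f ((s.rounds f x i).setReg x i)

namespace Cmd

/-- The effect of a command on a store. -/
def exec : Cmd → Store → Store
  | set x e, s => s.setReg x (e.eval s)
  | put a i e, s => s.setArr a (i.eval s) (e.eval s)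
  | seq p q, s => q.exec (p.exec s)
  | loop _ x e p, s => s.rounds p.exec x (e.eval s)

/-- All variables are below `k`, apart from those bound by sums. -/
def inScope : Cmd → ℕ → Bool
  | set x e, k => decide (x < k) && e.inScope k
  | put _ i e, k => i.inScope k && e.inScope k
  | seq p q, k => p.inScope k && q.inScope k
  | loop _ x e p, k => decide (x < k) && e.inScope k && p.inScope k

/-- All loops and sums have at most as many rounds as their extents promise. -/
def Fits (n W : ℕ) : Cmd → Store → Prop
  | set _ e, s => e.Fits n W s
  | put _ i e, s => i.Fits n W s ∧ e.Fits n W s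
  | seq p q, s => p.Fits n W s ∧ q.Fits n W (p.exec s)
  | loop b x e p, s => e.Fits n W s ∧ e.eval s ≤ b.eval n W ∧
      ∀ i < e.eval s, p.Fits n W ((s.rounds p.exec x i).setReg x i)

end Cmd

/-! ### Compilation to the machine -/

/-- The machine register that holds the variable `x`. -/
def varReg (x : ℕ) : ℕ := 2 * x

/-- The machine register that holds the `j`-th entry of the evaluation stack. -/
def tempReg (j : ℕ) : ℕ := 2 * j + 1

@[simp] theorem varReg_inj {x y : ℕ} : varReg x = varReg y ↔ x = y := by
  simp [varReg]

@[simp] theorem tempReg_inj {i j : ℕ} : tempReg i = tempReg j ↔ i = j := by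
  simp [tempReg]

@[simp] theorem varReg_ne_tempReg (x j : ℕ) : varReg x ≠ tempReg j := by
  simp only [varReg, tempReg]
  omega

@[simp] theorem tempReg_ne_varReg (j x : ℕ) : tempReg j ≠ varReg x :=
  (varReg_ne_tempReg x j).symm

/-- The program that executes `p` while the register `c` counts up to the content of the
register `b`; before each round the counter is copied to the register `x`. -/
def countLoop (b c x : ℕ) (p : Prog) : Prog :=
  .loop (.sub (.reg b) (.reg c))
    (.seq (.set x (.reg c)) (.seq p (.set c (.add (.reg c) (.const 1)))))

/-- A program that pushes the value of a term on an evaluation stack with `j` entries. -/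
def Term.code : Term → ℕ → Prog
  | const c, j => .set (tempReg j) (.const c)
  | var x, j => .set (tempReg j) (.reg (varReg x))
  | get a e, j => .seq (e.code j) (.set (tempReg j) (.get a (.reg (tempReg j))))
  | add e f, j => .seq (e.code j) (.seq (f.code (j + 1))
      (.set (tempReg j) (.add (.reg (tempReg j)) (.reg (tempReg (j + 1))))))
  | sub e f, j => .seq (e.code j) (.seq (f.code (j + 1))
      (.set (tempReg j) (.sub (.reg (tempReg j)) (.reg (tempReg (j + 1))))))
  | sum _ x e f, j => .seq (e.code j) (.seq (.set (tempReg (j + 1)) (.const 0))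
      (.seq (.set (tempReg (j + 2)) (.const 0))
      (.seq (countLoop (tempReg j) (tempReg (j + 2)) (varReg x) (.seq (f.code (j + 3))
          (.set (tempReg (j + 1)) (.add (.reg (tempReg (j + 1))) (.reg (tempReg (j + 3)))))))
        (.set (tempReg j) (.reg (tempReg (j + 1)))))))

/-- A bound on the number of steps of the code of a term. -/
def Term.bound (n W : ℕ) : Term → ℕ
  | const _ => 2
  | var _ => 2
  | get _ e => e.bound n W + 3
  | add e f => e.bound n W + f.bound n W + 4
  | sub e f => e.bound n W + f.bound n W + 4
  | sum b _ e f => e.bound n W + 10 + b.eval n W * (f.bound n W + 14)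

/-- The program of a command that leaves the first `j` entries of the evaluation stack alone. -/
def Cmd.code : Cmd → ℕ → Prog
  | set x e, j => .seq (e.code j) (.set (varReg x) (.reg (tempReg j)))
  | put a i e, j => .seq (i.code j) (.seq (e.code (j + 1))
      (.put a (.reg (tempReg j)) (.reg (tempReg (j + 1)))))
  | seq p q, j => .seq (p.code j) (q.code j)
  | loop _ x e p, j => .seq (e.code j) (.seq (.set (tempReg (j + 1)) (.const 0))
      (countLoop (tempReg j) (tempReg (j + 1)) (varReg x) (p.code (j + 2))))

/-- A bound on the number of steps of the code of a command. -/
def Cmd.bound (n W : ℕ) : Cmd → ℕ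
  | set _ e => e.bound n W + 2
  | put _ i e => i.bound n W + e.bound n W + 3
  | seq p q => p.bound n W + q.bound n W
  | loop b _ e p => e.bound n W + 6 + b.eval n W * (p.bound n W + 10)

/-! ### Correctness of the compilation -/

namespace Store

@[simp] theorem setReg_reg (s : Store) (x v y : ℕ) :
    (s.setReg x v).reg y = if y = x then v else s.reg y := by
  simp [setReg, Function.update_apply]

@[simp] theorem setArr_reg (s : Store) (a i v : ℕ) : (s.setArr a i v).reg = s.reg := rfl

end Store

/-- Started in the store `M`, the program `p` halts within `T` steps in a store satisfying `Q`. -/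
def Prog.HaltsWithin (p : Prog) (M : Store) (T : ℕ) (Q : Store → Prop) : Prop :=
  ∃ t M', Run p M t M' ∧ t ≤ T ∧ Q M'

namespace Prog.HaltsWithin

variable {p q : Prog} {M : Store} {T T' : ℕ} {Q R : Store → Prop}

theorem mono (h : p.HaltsWithin M T R) (hT : T ≤ T') (hQ : ∀ M', R M' → Q M') :
    p.HaltsWithin M T' Q :=
  let ⟨t, M', hrun, ht, hR⟩ := h
  ⟨t, M', hrun, ht.trans hT, hQ M' hR⟩

theorem set {x : ℕ} {e : RExpr} (h : Q (M.setReg x (e.eval M))) :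
    (Prog.set x e).HaltsWithin M (e.cost + 1) Q :=
  ⟨_, _, Run.set M x e, le_rfl, h⟩

theorem put {a : ℕ} {i e : RExpr} (h : Q (M.setArr a (i.eval M) (e.eval M))) :
    (Prog.put a i e).HaltsWithin M (i.cost + e.cost + 1) Q :=
  ⟨_, _, Run.put M a i e, le_rfl, h⟩

theorem seq (hp : p.HaltsWithin M T R) (hq : ∀ M', R M' → q.HaltsWithin M' T' Q) :
    (Prog.seq p q).HaltsWithin M (T + T') Q :=
  let ⟨_, M', hrun, ht, hR⟩ := hp
  let ⟨_, M'', hrun', ht', hQ⟩ := hq M' hR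
  ⟨_, M'', hrun.seq hrun', add_le_add ht ht', hQ⟩

theorem set_seq {x : ℕ} {e : RExpr} (h : q.HaltsWithin (M.setReg x (e.eval M)) T Q) :
    (Prog.seq (.set x e) q).HaltsWithin M (e.cost + 1 + T) Q :=
  .seq (R := (· = M.setReg x (e.eval M))) (.set rfl) fun _ hM' => hM' ▸ h

theorem countLoop {b c x N : ℕ} (I : ℕ → Store → Prop) (hb : ∀ i M, I i M → M.reg b = N)
    (hc : ∀ i M, I i M → M.reg c = i)
    (step : ∀ i < N, ∀ M, I i M → p.HaltsWithin (M.setReg x i) T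
      fun M' => I (i + 1) (M'.setReg c (M'.reg c + 1)))
    (h0 : I 0 M) : (countLoop b c x p).HaltsWithin M (N * (T + 10) + 4) (I N) := by
  suffices H : ∀ r i, i + r = N → ∀ M, I i M →
      (Boxicity.countLoop b c x p).HaltsWithin M (r * (T + 10) + 4) (I N) from
    H N 0 (zero_add N) M h0
  intro r
  induction r with
  | zero =>
    rintro i rfl M hM
    refine ⟨_, M, Run.loop_false ?_, by simp [RExpr.cost], hM⟩
    simp [RExpr.eval, hb _ _ hM, hc _ _ hM]
  | succ r ih =>
    intro i hi M hM
    obtain ⟨t, M', hrun, ht, hM'⟩ := step i (by omega) M hM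
    obtain ⟨t', M'', hrun', ht', hM''⟩ := ih (i + 1) (by omega) _ hM'
    have htest : (RExpr.sub (.reg b) (.reg c)).eval M ≠ 0 := by
      simp only [RExpr.eval, hb _ _ hM, hc _ _ hM]
      omega
    have hcopy : (RExpr.reg c).eval M = i := hc _ _ hM
    refine ⟨_, M'', Run.loop_true htest
      ((Run.set M x (.reg c)).seq ((hcopy.symm ▸ hrun).seq (Run.set _ _ _))) hrun', ?_, hM''⟩
    simp only [RExpr.cost, Nat.succ_mul]
    omega

end Prog.HaltsWithin

/-- The machine store `M` represents the store `s` as far as the variables below `k` go, and the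
first `j` entries of its evaluation stack are those of `τ`. -/
structure Represents (k j : ℕ) (τ : ℕ → ℕ) (M s : Store) : Prop where
  arr : M.arr = s.arr
  var : ∀ x < k, M.reg (varReg x) = s.reg x
  temp : ∀ i < j, M.reg (tempReg i) = τ i

namespace Represents

variable {k j v w : ℕ} {τ : ℕ → ℕ} {M s : Store}

theorem push (h : Represents k j τ M s) (v : ℕ) :
    Represents k (j + 1) (Function.update τ j v) (M.setReg (tempReg j) v) s where
  arr := h.arr
  var x hx := by simp [h.var x hx]
  temp i hi := by
    rcases Nat.lt_succ_iff_lt_or_eq.1 hi with hi | rfl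
    · simp [hi.ne, h.temp i hi]
    · simp

theorem pop (h : Represents k (j + 1) (Function.update τ j v) M s) : Represents k j τ M s where
  arr := h.arr
  var := h.var
  temp i hi := by simpa [hi.ne] using h.temp i (by omega)

theorem top (h : Represents k (j + 1) (Function.update τ j v) M s) : M.reg (tempReg j) = v := by
  simpa using h.temp j (Nat.lt_succ_self j)

theorem setVar (h : Represents k j τ M s) (x v : ℕ) :
    Represents k j τ (M.setReg (varReg x) v) (s.setReg x v) where
  arr := h.arr
  var y hy := by simp [h.var y hy]
  temp i hi := by simp [h.temp i hi]

theorem bind (h : Represents k j τ M s) (v : ℕ) :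
    Represents (k + 1) j τ (M.setReg (varReg k) v) (s.setReg k v) where
  arr := h.arr
  var y hy := by
    rcases Nat.lt_succ_iff_lt_or_eq.1 hy with hy | rfl
    · simp [hy.ne, h.var y hy]
    · simp
  temp := (h.setVar k v).temp

theorem unbind (h : Represents (k + 1) j τ M (s.setReg k v)) : Represents k j τ M s where
  arr := h.arr
  var y hy := by simpa [hy.ne] using h.var y (by omega)
  temp := h.temp

end Represents

/-- The code of `e` correctly pushes the value of `e` on the stack, within the bound for `e`. -/
def Term.CodeCorrect (n W : ℕ) (e : Term) : Prop :=
  ∀ ⦃k j : ℕ⦄ ⦃τ : ℕ → ℕ⦄ ⦃M s : Store⦄, e.inScope k → Represents k j τ M s → e.Fits n W s →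
    (e.code j).HaltsWithin M (e.bound n W)
      fun M' => Represents k (j + 1) (Function.update τ j (e.eval s)) M' s

namespace Term

variable {n W : ℕ} {e f : Term}

theorem codeCorrect_get (a : ℕ) (he : e.CodeCorrect n W) : (get a e).CodeCorrect n W := by
  intro k j τ M s hk hM hfit
  refine .seq (he hk hM hfit) fun M₁ h₁ => .set ?_
  simpa only [RExpr.eval, eval, h₁.top, h₁.arr] using h₁.pop.push _

theorem codeCorrect_add (he : e.CodeCorrect n W) (hf : f.CodeCorrect n W) :
    (add e f).CodeCorrect n W := by
  intro k j τ M s hk hM hfit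
  rw [inScope, Bool.and_eq_true] at hk
  refine .mono (.seq (he hk.1 hM hfit.1) fun M₁ h₁ => .seq (hf hk.2 h₁ hfit.2) fun M₂ h₂ =>
    .set (Q := fun M' => Represents k (j + 1) _ M' s) ?_) ?_ fun _ h => h
  · simpa only [RExpr.eval, eval, h₂.top, h₂.pop.top] using h₂.pop.pop.push _
  · simp only [bound, RExpr.cost]
    omega

theorem codeCorrect_sub (he : e.CodeCorrect n W) (hf : f.CodeCorrect n W) :
    (sub e f).CodeCorrect n W := by
  intro k j τ M s hk hM hfit
  rw [inScope, Bool.and_eq_true] at hk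
  refine .mono (.seq (he hk.1 hM hfit.1) fun M₁ h₁ => .seq (hf hk.2 h₁ hfit.2) fun M₂ h₂ =>
    .set (Q := fun M' => Represents k (j + 1) _ M' s) ?_) ?_ fun _ h => h
  · simpa only [RExpr.eval, eval, h₂.top, h₂.pop.top] using h₂.pop.pop.push _
  · simp only [bound, RExpr.cost]
    omega

theorem codeCorrect_sum (b : Extent) (x : ℕ) (he : e.CodeCorrect n W) (hf : f.CodeCorrect n W) :
    (sum b x e f).CodeCorrect n W := by
  intro k j τ M s hk hM ⟨hfe, hN, hff⟩
  simp only [inScope, Bool.and_eq_true, decide_eq_true_eq] at hk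
  obtain ⟨⟨rfl, hke⟩, hkf⟩ := hk
  let S (i : ℕ) : ℕ := ∑ i ∈ Finset.range i, f.eval (s.setReg x i)
  let I (i : ℕ) (M' : Store) : Prop := Represents x (j + 3) (Function.update (Function.update
    (Function.update τ j (e.eval s)) (j + 1) (S i)) (j + 2) i) M' s
  have hloop : ∀ M₁, I 0 M₁ → (countLoop (tempReg j) (tempReg (j + 2)) (varReg x)
      (.seq (f.code (j + 3)) (.set (tempReg (j + 1))
        (.add (.reg (tempReg (j + 1))) (.reg (tempReg (j + 3))))))).HaltsWithin M₁
      (e.eval s * (f.bound n W + 4 + 10) + 4) (I (e.eval s)) := fun M₁ =>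
    .countLoop I (fun i M₂ h => h.pop.pop.top) (fun i M₂ h => h.top) fun i hi M₂ h =>
      .seq (hf hkf (h.bind i) (hff i hi)) fun M₃ h₃ => .set (by
        simpa [RExpr.eval, h₃.top, h₃.pop.top, h₃.pop.pop.top, I, S, Finset.sum_range_succ]
          using ((h₃.pop.pop.pop.push (S i + f.eval (s.setReg x i))).push (i + 1)).unbind)
  refine .mono (.seq (he hke hM hfe) fun M₁ h₁ => .set_seq (.set_seq
    (.seq (hloop _ ((h₁.push 0).push 0)) fun M₂ h₂ =>
    .set (Q := fun M' => Represents x (j + 1) _ M' s) ?_))) ?_ fun _ h => h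
  · simpa only [RExpr.eval, eval, h₂.pop.top] using h₂.pop.pop.pop.push _
  · have : e.eval s * (f.bound n W + 4 + 10) ≤ b.eval n W * (f.bound n W + 14) :=
      Nat.mul_le_mul_right _ hN
    simp only [bound, RExpr.cost]
    omega

theorem codeCorrect (n W : ℕ) : ∀ e : Term, e.CodeCorrect n W
  | const c => fun _ _ _ _ _ _ hM _ => .set (hM.push c)
  | var x => fun k j τ M s hk hM _ => .set (by
      simpa only [RExpr.eval, eval, hM.var x (of_decide_eq_true hk)] using hM.push _)
  | get a e => codeCorrect_get a (codeCorrect n W e)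
  | add e f => codeCorrect_add (codeCorrect n W e) (codeCorrect n W f)
  | sub e f => codeCorrect_sub (codeCorrect n W e) (codeCorrect n W f)
  | sum b x e f => codeCorrect_sum b x (codeCorrect n W e) (codeCorrect n W f)

end Term

/-- The code of `p` correctly executes `p` and preserves the stack, within the bound for `p`. -/
def Cmd.CodeCorrect (n W : ℕ) (p : Cmd) : Prop :=
  ∀ ⦃k j : ℕ⦄ ⦃τ : ℕ → ℕ⦄ ⦃M s : Store⦄, p.inScope k → Represents k j τ M s → p.Fits n W s →
    (p.code j).HaltsWithin M (p.bound n W) fun M' => Represents k j τ M' (p.exec s)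

namespace Cmd

variable {n W : ℕ} {p q : Cmd}

theorem codeCorrect_set (x : ℕ) (e : Term) : (set x e).CodeCorrect n W := by
  intro k j τ M s hk hM hfit
  rw [inScope, Bool.and_eq_true] at hk
  refine .seq (e.codeCorrect n W hk.2 hM hfit) fun M₁ h₁ => .set ?_
  simpa only [RExpr.eval, exec, h₁.top] using h₁.pop.setVar x _

theorem codeCorrect_put (a : ℕ) (i e : Term) : (put a i e).CodeCorrect n W := by
  intro k j τ M s hk hM hfit
  rw [inScope, Bool.and_eq_true] at hk
  refine .mono (.seq (i.codeCorrect n W hk.1 hM hfit.1) fun M₁ h₁ =>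
    .seq (e.codeCorrect n W hk.2 h₁ hfit.2) fun M₂ h₂ =>
    .put (Q := fun M' => Represents k j τ M' _) ?_) ?_ fun _ h => h
  · simp only [RExpr.eval, h₂.top, h₂.pop.top]
    exact ⟨by simp only [exec, Store.setArr, h₂.arr], h₂.var, h₂.pop.pop.temp⟩
  · simp only [bound, RExpr.cost]
    omega

theorem codeCorrect_seq (hp : p.CodeCorrect n W) (hq : q.CodeCorrect n W) :
    (seq p q).CodeCorrect n W := by
  intro k j τ M s hk hM hfit
  rw [inScope, Bool.and_eq_true] at hk
  exact .seq (hp hk.1 hM hfit.1) fun M₁ h₁ => hq hk.2 h₁ hfit.2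

theorem codeCorrect_loop (b : Extent) (x : ℕ) (e : Term) (hp : p.CodeCorrect n W) :
    (loop b x e p).CodeCorrect n W := by
  intro k j τ M s hk hM ⟨hfe, hN, hfp⟩
  simp only [inScope, Bool.and_eq_true, decide_eq_true_eq] at hk
  let I (i : ℕ) (M' : Store) : Prop := Represents k (j + 2) (Function.update
    (Function.update τ j (e.eval s)) (j + 1) i) M' (s.rounds p.exec x i)
  have hloop : ∀ M₁, I 0 M₁ → (countLoop (tempReg j) (tempReg (j + 1)) (varReg x)
      (p.code (j + 2))).HaltsWithin M₁ (e.eval s * (p.bound n W + 10) + 4) (I (e.eval s)) :=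
    fun M₁ => .countLoop I (fun i M₂ h => h.pop.top) (fun i M₂ h => h.top) fun i hi M₂ h =>
      .mono (hp hk.2 (h.setVar x i) (hfp i hi)) le_rfl fun M₃ h₃ => by
        simpa only [I, Store.rounds, h₃.top] using h₃.pop.push (i + 1)
  refine .mono (.seq (e.codeCorrect n W hk.1.2 hM hfe) fun M₁ h₁ =>
    .set_seq (hloop _ (h₁.push 0))) ?_ fun M' h => h.pop.pop
  have := Nat.mul_le_mul_right (p.bound n W + 10) hN
  simp only [bound, RExpr.cost]
  omega

theorem codeCorrect (n W : ℕ) : ∀ p : Cmd, p.CodeCorrect n W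
  | set x e => codeCorrect_set x e
  | put a i e => codeCorrect_put a i e
  | seq p q => codeCorrect_seq (codeCorrect n W p) (codeCorrect n W q)
  | loop b x e p => codeCorrect_loop b x e (codeCorrect n W p)

end Cmd

/-! ### The order of growth of the running time -/

/-- `f n W = O(n ^ a * W ^ b)`, where `n` and `W` are positive. -/
def IsPolyBounded (a b : ℕ) (f : ℕ → ℕ → ℕ) : Prop :=
  ∃ K, ∀ n W, 0 < n → 0 < W → f n W ≤ K * (n ^ a * W ^ b)

namespace IsPolyBounded

variable {a a' b b' : ℕ} {f g : ℕ → ℕ → ℕ}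

theorem mono (h : IsPolyBounded a b f) (ha : a ≤ a') (hb : b ≤ b') : IsPolyBounded a' b' f :=
  let ⟨K, hK⟩ := h
  ⟨K, fun n W hn hW => (hK n W hn hW).trans (Nat.mul_le_mul_left K
    (Nat.mul_le_mul (Nat.pow_le_pow_right hn ha) (Nat.pow_le_pow_right hW hb)))⟩

theorem const (a b c : ℕ) : IsPolyBounded a b fun _ _ => c :=
  ⟨c, fun _ _ hn hW => Nat.le_mul_of_pos_right c (Nat.mul_pos (Nat.pow_pos hn) (Nat.pow_pos hW))⟩

theorem add (hf : IsPolyBounded a b f) (hg : IsPolyBounded a b g) :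
    IsPolyBounded a b fun n W => f n W + g n W :=
  let ⟨K, hK⟩ := hf
  let ⟨L, hL⟩ := hg
  ⟨K + L, fun n W hn hW => by rw [add_mul]; exact add_le_add (hK n W hn hW) (hL n W hn hW)⟩

theorem max_add (hf : IsPolyBounded a b f) (hg : IsPolyBounded a' b' g) (c : ℕ) :
    IsPolyBounded (max a a') (max b b') fun n W => f n W + g n W + c :=
  ((hf.mono (le_max_left _ _) (le_max_left _ _)).add
    (hg.mono (le_max_right _ _) (le_max_right _ _))).add (const _ _ c)

theorem extent_mul (x : Extent) (hf : IsPolyBounded a b f) :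
    IsPolyBounded (a + if x = .vertices then 1 else 0) (b + if x = .trials then 1 else 0)
      fun n W => x.eval n W * f n W := by
  obtain ⟨K, hK⟩ := hf
  refine ⟨K, fun n W hn hW => (Nat.mul_le_mul_left _ (hK n W hn hW)).trans_eq ?_⟩
  cases x <;> simp [Extent.eval] <;> ring

end IsPolyBounded

namespace Term

/-- The nesting depth of the sums with extent `x`. -/
def deg (x : Extent) : Term → ℕ
  | const _ => 0
  | var _ => 0
  | get _ e => e.deg x
  | add e f => max (e.deg x) (f.deg x)
  | sub e f => max (e.deg x) (f.deg x)
  | sum b _ e f => max (e.deg x) (f.deg x + if b = x then 1 else 0)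

theorem isPolyBounded_bound : ∀ e : Term,
    IsPolyBounded (e.deg .vertices) (e.deg .trials) fun n W => e.bound n W
  | const _ => .const 0 0 2
  | var _ => .const 0 0 2
  | get _ e => e.isPolyBounded_bound.add (.const _ _ 3)
  | add e f => e.isPolyBounded_bound.max_add f.isPolyBounded_bound 4
  | sub e f => e.isPolyBounded_bound.max_add f.isPolyBounded_bound 4
  | sum b _ e f => (e.isPolyBounded_bound.add (.const _ _ 10)).max_add
      ((f.isPolyBounded_bound.add (.const _ _ 14)).extent_mul b) 0

end Term

namespace Cmd

/-- The nesting depth of the loops and sums with extent `x`. -/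
def deg (x : Extent) : Cmd → ℕ
  | set _ e => e.deg x
  | put _ i e => max (i.deg x) (e.deg x)
  | seq p q => max (p.deg x) (q.deg x)
  | loop b _ e p => max (e.deg x) (p.deg x + if b = x then 1 else 0)

theorem isPolyBounded_bound : ∀ p : Cmd,
    IsPolyBounded (p.deg .vertices) (p.deg .trials) fun n W => p.bound n W
  | set _ e => e.isPolyBounded_bound.add (.const _ _ 2)
  | put _ i e => i.isPolyBounded_bound.max_add e.isPolyBounded_bound 3
  | seq p q => p.isPolyBounded_bound.max_add q.isPolyBounded_bound 0
  | loop b _ e p => (e.isPolyBounded_bound.add (.const _ _ 6)).max_add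
      ((p.isPolyBounded_bound.add (.const _ _ 10)).extent_mul b) 0

end Cmd

/-! ### Values of terms -/

/-- In the store `s`, the term `e` has the value `v` and keeps to the promised numbers of
summands. -/
def Term.HasValue (n W : ℕ) (s : Store) (e : Term) (v : ℕ) : Prop :=
  e.Fits n W s ∧ e.eval s = v

open Classical in
/-- In the store `s`, the value of the term `e` is the truth value, `1` or `0`, of `P`. -/
def Term.Decides (n W : ℕ) (s : Store) (e : Term) (P : Prop) : Prop :=
  e.HasValue n W s (if P then 1 else 0)

namespace Term

/-- Negation of a truth value. -/
def not (e : Term) : Term := sub (const 1) e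

/-- Conjunction of truth values. -/
def and (e f : Term) : Term := not (add (not e) (not f))

/-- Disjunction of truth values. -/
def or (e f : Term) : Term := not (and (not e) (not f))

/-- Implication of truth values. -/
def imp (e f : Term) : Term := not (and e (not f))

/-- The truth value of `e ≤ f`. -/
def le (e f : Term) : Term := not (sub e f)

/-- The truth value of `e < f`. -/
def lt (e f : Term) : Term := le (add e (const 1)) f

/-- The truth value of `e = f`. -/
def eq (e f : Term) : Term := and (le e f) (le f e)

/-- The truth value of `f` holding for all `x < e`. -/
def all (b : Extent) (x : ℕ) (e f : Term) : Term := not (sum b x e (not f))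

/-- The truth value of `f` holding for some `x < e`. -/
def any (b : Extent) (x : ℕ) (e f : Term) : Term := not (all b x e (not f))

/-- The product, as a sum of `e` copies of `f` indexed by `x`. -/
def mul (x : ℕ) (e f : Term) : Term := sum .trials x e f

/-- Case distinction by a truth value `c`; the variable `x` is auxiliary. -/
def ite (x : ℕ) (c e f : Term) : Term := add (mul x c e) (mul x (not c) f)

variable {n W : ℕ} {s : Store} {c e f : Term} {u v x : ℕ} {P Q : Prop}

namespace HasValue

theorem const (v : ℕ) : (const v).HasValue n W s v := ⟨trivial, rfl⟩

theorem var (h : s.reg x = v) : (var x).HasValue n W s v := ⟨trivial, h⟩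

theorem get {a : ℕ} (he : e.HasValue n W s u) (h : s.arr a u = v) :
    (get a e).HasValue n W s v :=
  ⟨he.1, by rw [eval, he.2, h]⟩

theorem add (he : e.HasValue n W s u) (hf : f.HasValue n W s v) :
    (add e f).HasValue n W s (u + v) :=
  ⟨⟨he.1, hf.1⟩, by rw [eval, he.2, hf.2]⟩

theorem sub (he : e.HasValue n W s u) (hf : f.HasValue n W s v) :
    (sub e f).HasValue n W s (u - v) :=
  ⟨⟨he.1, hf.1⟩, by rw [eval, he.2, hf.2]⟩

theorem sum {b : Extent} {g : ℕ → ℕ} (he : e.HasValue n W s v) (hv : v ≤ b.eval n W)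
    (hf : ∀ i < v, f.HasValue n W (s.setReg x i) (g i)) :
    (sum b x e f).HasValue n W s (∑ i ∈ Finset.range v, g i) := by
  obtain ⟨he, rfl⟩ := he
  exact ⟨⟨he, hv, fun i hi => (hf i hi).1⟩,
    Finset.sum_congr rfl fun i hi => (hf i (Finset.mem_range.1 hi)).2⟩

theorem mul (he : e.HasValue n W s u) (hu : u ≤ W)
    (hf : ∀ i < u, f.HasValue n W (s.setReg x i) v) : (mul x e f).HasValue n W s (u * v) := by
  simpa [Term.mul] using HasValue.sum (b := .trials) he hu hf

end HasValue

namespace Decides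

theorem congr (h : e.Decides n W s P) (hPQ : P ↔ Q) : e.Decides n W s Q :=
  propext hPQ ▸ h

theorem hasValue [Decidable P] (h : e.Decides n W s P) :
    e.HasValue n W s (if P then 1 else 0) := by
  rw [Decides] at h
  convert h

theorem hasValue_one (h : e.Decides n W s P) (hP : P) : e.HasValue n W s 1 := by
  rwa [Decides, if_pos hP] at h

theorem hasValue_zero (h : e.Decides n W s P) (hP : ¬ P) : e.HasValue n W s 0 := by
  rwa [Decides, if_neg hP] at h

theorem eq_zero (he : e.HasValue n W s v) : (Term.not e).Decides n W s (v = 0) := by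
  refine ⟨⟨trivial, he.1⟩, ?_⟩
  simp only [Term.not, eval, he.2]
  split_ifs <;> omega

theorem not (h : e.Decides n W s P) : (not e).Decides n W s (¬ P) :=
  (eq_zero h).congr (by simp)

theorem and (he : e.Decides n W s P) (hf : f.Decides n W s Q) :
    (and e f).Decides n W s (P ∧ Q) :=
  (eq_zero (HasValue.add he.not hf.not)).congr (by simp)

theorem or (he : e.Decides n W s P) (hf : f.Decides n W s Q) :
    (or e f).Decides n W s (P ∨ Q) :=
  (he.not.and hf.not).not.congr or_iff_not_and_not.symm

theorem imp (he : e.Decides n W s P) (hf : f.Decides n W s Q) :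
    (imp e f).Decides n W s (P → Q) :=
  (he.and hf.not).not.congr not_and_not_right

theorem le (he : e.HasValue n W s u) (hf : f.HasValue n W s v) :
    (le e f).Decides n W s (u ≤ v) :=
  (eq_zero (he.sub hf)).congr Nat.sub_eq_zero_iff_le

theorem lt (he : e.HasValue n W s u) (hf : f.HasValue n W s v) :
    (lt e f).Decides n W s (u < v) :=
  .le (he.add (.const 1)) hf

theorem eq (he : e.HasValue n W s u) (hf : f.HasValue n W s v) :
    (eq e f).Decides n W s (u = v) :=
  ((le he hf).and (le hf he)).congr le_antisymm_iff.symm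

theorem iff (he : e.Decides n W s P) (hf : f.Decides n W s Q) :
    (Term.eq e f).Decides n W s (P ↔ Q) :=
  (eq he hf).congr (by by_cases P <;> by_cases Q <;> simp [*])

theorem all {b : Extent} {P : Fin v → Prop} (he : e.HasValue n W s v) (hv : v ≤ b.eval n W)
    (hf : ∀ i : Fin v, f.Decides n W (s.setReg x i) (P i)) :
    (all b x e f).Decides n W s (∀ i, P i) := by
  have hf' i (hi : i < v) : f.Decides n W (s.setReg x i) (∀ h, P ⟨i, h⟩) :=
    (hf ⟨i, hi⟩).congr ⟨fun h _ => h, fun h => h hi⟩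
  exact (eq_zero (he.sum hv fun i hi => (hf' i hi).not)).congr
    (by simp [Finset.sum_eq_zero_iff, Fin.forall_iff])

theorem any {b : Extent} {P : Fin v → Prop} (he : e.HasValue n W s v) (hv : v ≤ b.eval n W)
    (hf : ∀ i : Fin v, f.Decides n W (s.setReg x i) (P i)) :
    (any b x e f).Decides n W s (∃ i, P i) :=
  (all he hv fun i => (hf i).not).not.congr (by push Not; rfl)

theorem ite (hW : 0 < W) (hc : c.Decides n W s P)
    (he : P → e.HasValue n W (s.setReg x 0) v) (hf : ¬ P → f.HasValue n W (s.setReg x 0) v) :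
    (ite x c e f).HasValue n W s v := by
  by_cases hP : P
  · have h₁ := (hc.hasValue_one hP).mul (v := v) (x := x) (f := e) hW (by simpa using he hP)
    have h₀ := (hc.not.hasValue_zero (not_not.2 hP)).mul (v := v) (x := x) (f := f)
      (Nat.zero_le W) (by simp)
    simpa [Term.ite] using h₁.add h₀
  · have h₁ := (hc.not.hasValue_one hP).mul (v := v) (x := x) (f := f) hW (by simpa using hf hP)
    have h₀ := (hc.hasValue_zero hP).mul (v := v) (x := x) (f := e) (Nat.zero_le W) (by simp)
    simpa [Term.ite] using h₀.add h₁

end Decides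

end Term

/-! ### Total correctness of commands -/

/-- Execute `p` if the truth value of `e` is `1`; the variable `x` is auxiliary. -/
def Cmd.when (x : ℕ) (e : Term) (p : Cmd) : Cmd := loop .trials x e p

/-- Started in `s`, the command `p` keeps to the promised numbers of rounds and achieves `Q`. -/
def Cmd.Ok (n W : ℕ) (p : Cmd) (s : Store) (Q : Store → Prop) : Prop :=
  p.Fits n W s ∧ Q (p.exec s)

namespace Cmd.Ok

variable {n W : ℕ} {p q : Cmd} {s : Store} {Q R : Store → Prop} {e : Term} {u v x : ℕ}
  {b : Extent}

theorem mono (h : p.Ok n W s R) (hQ : ∀ s', R s' → Q s') : p.Ok n W s Q :=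
  ⟨h.1, hQ _ h.2⟩

theorem seq (hp : p.Ok n W s R) (hq : ∀ s', R s' → q.Ok n W s' Q) : (Cmd.seq p q).Ok n W s Q :=
  ⟨⟨hp.1, (hq _ hp.2).1⟩, (hq _ hp.2).2⟩

theorem set (he : e.HasValue n W s v) (h : Q (s.setReg x v)) : (Cmd.set x e).Ok n W s Q :=
  ⟨he.1, by rwa [exec, he.2]⟩

theorem put {a : ℕ} {i : Term} (hi : i.HasValue n W s u) (he : e.HasValue n W s v)
    (h : Q (s.setArr a u v)) : (Cmd.put a i e).Ok n W s Q :=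
  ⟨⟨hi.1, he.1⟩, by rwa [exec, hi.2, he.2]⟩

theorem loop (I : ℕ → Store → Prop) (he : e.HasValue n W s v) (hv : v ≤ b.eval n W) (h0 : I 0 s)
    (step : ∀ i < v, ∀ s', I i s' → p.Ok n W (s'.setReg x i) (I (i + 1))) :
    (Cmd.loop b x e p).Ok n W s (I v) := by
  obtain ⟨he, rfl⟩ := he
  have key : ∀ i ≤ e.eval s, I i (s.rounds p.exec x i) := by
    intro i
    induction i with
    | zero => exact fun _ => h0
    | succ i ih => exact fun hi => (step i hi _ (ih (Nat.le_of_succ_le hi))).2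
  exact ⟨⟨he, hv, fun i hi => (step i hi _ (key i hi.le)).1⟩, key _ le_rfl⟩

theorem when {P : Prop} (hW : 0 < W) (he : e.Decides n W s P)
    (hp : P → p.Ok n W (s.setReg x 0) Q) (hQ : ¬ P → Q s) : (Cmd.when x e p).Ok n W s Q := by
  by_cases hP : P
  · have h := he.hasValue_one hP
    refine ⟨⟨h.1, h.2.trans_le hW, fun i hi => ?_⟩, ?_⟩
    · obtain rfl : i = 0 := by rw [h.2] at hi; omega
      exact (hp hP).1
    · simpa [Cmd.when, exec, h.2, Store.rounds] using (hp hP).2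
  · exact .loop (fun _ => Q) (he.hasValue_zero hP) (Nat.zero_le _) (hQ hP)
      fun i hi => absurd hi i.not_lt_zero

end Cmd.Ok

/-! ### Box representations as systems of inequalities -/

section Models

variable {V α ι κ : Type*}

/-- Two distinct vertices are adjacent if and only if their intervals `[l i v, r i v]` satisfy the
inequalities that express that they meet, for every `i`; the case of equal vertices says that the
intervals are nonempty. This is a box representation with end points in an ordered type. -/
def IsBoxModel [LE α] (G : SimpleGraph V) (l r : ι → V → α) : Prop :=
  ∀ u v, (u = v ∨ G.Adj u v) ↔ ∀ i, l i u ≤ r i v ∧ l i v ≤ r i u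

theorem intervalGraph_adj_iff {l r : V → ℝ} (h : ∀ v, l v ≤ r v) {u v : V} :
    (intervalGraph l r).Adj u v ↔ u ≠ v ∧ l u ≤ r v ∧ l v ≤ r u := by
  simp only [intervalGraph, Set.Icc_inter_Icc, Set.nonempty_Icc, max_le_iff, le_min_iff]
  have := h u
  have := h v
  tauto

theorem isBoxRep_iff_isBoxModel {G : SimpleGraph V} {d : ℕ} {l r : Fin d → V → ℝ} :
    IsBoxRep G d l r ↔ IsBoxModel G l r := by
  have key (h : ∀ i v, l i v ≤ r i v) :
      G = (⨅ i, intervalGraph (l i) (r i)) ↔ IsBoxModel G l r := by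
    simp only [SimpleGraph.ext_iff, funext_iff, eq_iff_iff, SimpleGraph.iInf_adj,
      intervalGraph_adj_iff (h _)]
    refine forall₂_congr fun u v => ?_
    rcases eq_or_ne u v with rfl | huv
    · simp [h]
    · simp [huv]
  exact ⟨fun h => (key h.1).1 h.2, fun h =>
    have hle i v : l i v ≤ r i v := ((h v v).1 (.inl rfl) i).1
    ⟨hle, (key hle).2 h⟩⟩

theorem isBoxRep_natCast_iff {G : SimpleGraph V} {d : ℕ} {l r : Fin d → V → ℕ} :
    IsBoxRep G d (fun i v => (l i v : ℝ)) (fun i v => (r i v : ℝ)) ↔ IsBoxModel G l r := by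
  simp only [isBoxRep_iff_isBoxModel, IsBoxModel, Nat.cast_le]

namespace IsBoxModel

variable {G : SimpleGraph V}

theorem comp_equiv [LE α] {l r : ι → V → α} (h : IsBoxModel G l r) (e : κ ≃ ι) :
    IsBoxModel G (l ∘ e) (r ∘ e) := fun u v =>
  (h u v).trans e.forall_congr_right.symm

theorem map {β : Type*} [LinearOrder α] [Preorder β] {l r : ι → V → α} {φ : ι → α → β}
    {s : ι → Set α} (h : IsBoxModel G l r) (hφ : ∀ i, StrictMonoOn (φ i) (s i))
    (hl : ∀ i v, l i v ∈ s i) (hr : ∀ i v, r i v ∈ s i) :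
    IsBoxModel G (fun i v => φ i (l i v)) (fun i v => φ i (r i v)) := fun u v => by
  simp only [(hφ _).le_iff_le (hl _ _) (hr _ _), h u v]

end IsBoxModel

/-! ### The upper bound on the boxicity -/

/-- The graph has a box representation of dimension `d`. -/
def HasBoxRep (G : SimpleGraph V) (d : ℕ) : Prop :=
  ∃ l r : Fin d → V → ℝ, IsBoxRep G d l r

theorem boxicity_le_of_hasBoxRep {G : SimpleGraph V} {d : ℕ} (h : HasBoxRep G d) :
    boxicity G ≤ d :=
  sInf_le ⟨d, rfl, h⟩

theorem boxicity_eq {G : SimpleGraph V} {d : ℕ} (h : HasBoxRep G d)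
    (hlt : ∀ d' < d, ¬ HasBoxRep G d') : boxicity G = d := by
  refine (boxicity_le_of_hasBoxRep h).antisymm (le_sInf ?_)
  rintro _ ⟨m, rfl, hm⟩
  exact Nat.cast_le.2 (not_lt.1 fun hc => hlt m hc hm)

open Classical in
theorem isBoxModel_of_isClique_compl (G : SimpleGraph V) {A : Set V} (hA : G.IsClique Aᶜ) :
    IsBoxModel G (fun (w : A) v => if v = w ∨ G.Adj w v then 0 else 1)
      (fun w v => if v = w then 0 else 1) := by
  intro u v
  constructor
  · rintro (rfl | h) i
    · constructor <;> dsimp only <;> split_ifs <;> simp_all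
    · constructor <;> dsimp only <;> split_ifs <;> simp_all [G.adj_comm]
  · intro h
    by_contra! hn
    have hor : u ∈ A ∨ v ∈ A := by
      by_contra! hc
      exact hn.2 (hA hc.1 hc.2 hn.1)
    rcases hor with hu | hv
    · have := (h ⟨u, hu⟩).2
      simp [hn.1.symm, hn.2] at this
    · have := (h ⟨v, hv⟩).1
      simp [hn.1, G.adj_comm v u, hn.2] at this

theorem hasBoxRep_card (G : SimpleGraph V) {A : Finset V} (hA : G.IsClique (A : Set V)ᶜ) :
    HasBoxRep G A.card :=
  ⟨_, _, isBoxRep_natCast_iff.2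
    ((isBoxModel_of_isClique_compl G hA).comp_equiv A.equivFin.symm)⟩

theorem encard_compl_le [Fintype V] {S : Finset V} {k : ℕ}
    (h : Fintype.card V ≤ S.card + k) : (S : Set V)ᶜ.encard ≤ k := by
  classical
  rw [← Finset.coe_compl, Set.encard_coe_eq_coe_finsetCard, Nat.cast_le, Finset.card_compl]
  omega

theorem boxicity_le_of_isClique {G : SimpleGraph V} {S : Set V} {k : ℕ} (hS : G.IsClique S)
    (hk : Sᶜ.encard ≤ k) : boxicity G ≤ k := by
  have hfin : Sᶜ.Finite := Set.finite_of_encard_le_coe hk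
  refine (boxicity_le_of_hasBoxRep (hasBoxRep_card G (A := hfin.toFinset) (by simpa))).trans ?_
  rwa [← hfin.encard_eq_coe_toFinset_card]

/-! ### Ranks -/

/-- The number of elements of `A` below `x`. -/
def rank [LinearOrder α] (A : Finset α) (x : α) : ℕ :=
  (A.filter (· < x)).card

section Rank

variable [LinearOrder α] {A : Finset α} {x y : α}

theorem rank_monotone (A : Finset α) : Monotone (rank A) := fun _ _ hxy =>
  Finset.card_le_card (Finset.monotone_filter_right A fun _ _ hz => lt_of_lt_of_le hz hxy)

theorem rank_strictMonoOn (A : Finset α) : StrictMonoOn (rank A) A := fun x hx _ _ hxy =>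
  Finset.card_lt_card ⟨Finset.monotone_filter_right A fun _ _ hz => lt_trans hz hxy, fun hsub =>
    lt_irrefl x (Finset.mem_filter.1 (hsub (Finset.mem_filter.2 ⟨hx, hxy⟩))).2⟩

theorem rank_lt_card (hx : x ∈ A) : rank A x < A.card :=
  Finset.card_lt_card (Finset.filter_ssubset.2 ⟨x, hx, lt_irrefl x⟩)

theorem exists_monotone_nat (E : Finset α) (p : α) {N : ℕ} (hE : E.card ≤ N) :
    ∃ φ : α → ℕ, Monotone φ ∧ StrictMonoOn φ (insert p E : Finset α) ∧ φ p = N ∧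
      ∀ x ∈ insert p E, φ x ≤ 2 * N := by
  have hlt x (hx : x ∈ insert p E) : rank (insert p E) x ≤ N :=
    Nat.le_of_lt_succ ((rank_lt_card hx).trans_le ((Finset.card_insert_le p E).trans (by omega)))
  have hp := hlt p (Finset.mem_insert_self p E)
  refine ⟨fun x => rank (insert p E) x + (N - rank (insert p E) p),
    (rank_monotone _).add_const _, (rank_strictMonoOn _).add_const _, Nat.add_sub_cancel' hp,
    fun x hx => ?_⟩
  rw [two_mul]
  exact add_le_add (hlt x hx) (Nat.sub_le _ _)

end Rank

/-! ### Extending intervals from a set of vertices -/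

theorem fold_mem {op : α → α → α} [Std.Commutative op] [Std.Associative op] {s : Set α}
    {A : Finset V} {q : α} {a : V → α}
    (hop : ∀ x ∈ s, ∀ y ∈ s, op x y ∈ s) (hq : q ∈ s) (ha : ∀ v ∈ A, a v ∈ s) :
    A.fold op q a ∈ s := by
  classical
  induction A using Finset.induction_on with
  | empty => exact hq
  | insert w A hw ih =>
    rw [Finset.fold_insert hw]
    rw [Finset.forall_mem_insert] at ha
    exact hop _ ha.1 _ (ih ha.2)

section Extension

variable [LinearOrder α] {G : SimpleGraph V} {A : Finset V} {q x : α} {a b : V → α} {v w : V}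

open Classical in
/-- The left end points `a` of the vertices of `A`, extended to all vertices: the interval of a
vertex `v ∉ A` becomes the least one that contains `q` and meets the intervals `[a w, b w]` of the
neighbours `w ∈ A` of `v`. -/
noncomputable def extLeft (G : SimpleGraph V) (A : Finset V) (q : α) (a b : V → α) (v : V) : α :=
  if v ∈ A then a v else (A.filter (G.Adj v)).fold min q b

open Classical in
/-- The right end points that belong to the left end points `extLeft G A q a b`. -/
noncomputable def extRight (G : SimpleGraph V) (A : Finset V) (q : α) (a b : V → α) (v : V) : α :=
  if v ∈ A then b v else (A.filter (G.Adj v)).fold max q a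

theorem extLeft_of_mem (hv : v ∈ A) : extLeft G A q a b v = a v := if_pos hv

theorem extRight_of_mem (hv : v ∈ A) : extRight G A q a b v = b v := if_pos hv

theorem extLeft_congr {a' b' : V → α} (h : ∀ v ∈ A, a v = a' v ∧ b v = b' v) :
    extLeft G A q a b = extLeft G A q a' b' := by
  classical
  funext v
  refine if_ctx_congr Iff.rfl (fun hv => (h v hv).1) fun _ => Finset.fold_congr fun w hw => ?_
  exact (h w (Finset.mem_filter.1 hw).1).2

theorem extRight_congr {a' b' : V → α} (h : ∀ v ∈ A, a v = a' v ∧ b v = b' v) :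
    extRight G A q a b = extRight G A q a' b' := by
  classical
  funext v
  refine if_ctx_congr Iff.rfl (fun hv => (h v hv).2) fun _ => Finset.fold_congr fun w hw => ?_
  exact (h w (Finset.mem_filter.1 hw).1).1

theorem le_extLeft_iff (hv : v ∉ A) :
    x ≤ extLeft G A q a b v ↔ x ≤ q ∧ ∀ w ∈ A, G.Adj v w → x ≤ b w := by
  simp [extLeft, hv, Finset.le_fold_min]

theorem lt_extLeft_iff (hv : v ∉ A) :
    x < extLeft G A q a b v ↔ x < q ∧ ∀ w ∈ A, G.Adj v w → x < b w := by
  simp [extLeft, hv, Finset.lt_fold_min]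

theorem extRight_le_iff (hv : v ∉ A) :
    extRight G A q a b v ≤ x ↔ q ≤ x ∧ ∀ w ∈ A, G.Adj v w → a w ≤ x := by
  simp [extRight, hv, Finset.fold_max_le]

theorem lt_extRight_iff (hv : v ∉ A) :
    x < extRight G A q a b v ↔ x < q ∨ ∃ w ∈ A, G.Adj v w ∧ x < a w := by
  simp [extRight, hv, Finset.lt_fold_max, and_assoc]

theorem map_extLeft {β : Type*} [LinearOrder β] {φ : α → β} (hφ : Monotone φ) :
    φ (extLeft G A q a b v) = extLeft G A (φ q) (φ ∘ a) (φ ∘ b) v := by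
  rw [extLeft, apply_ite φ, ← Finset.fold_hom fun _ _ => hφ.map_min]
  rfl

theorem map_extRight {β : Type*} [LinearOrder β] {φ : α → β} (hφ : Monotone φ) :
    φ (extRight G A q a b v) = extRight G A (φ q) (φ ∘ a) (φ ∘ b) v := by
  rw [extRight, apply_ite φ, ← Finset.fold_hom fun _ _ => hφ.map_max]
  rfl

theorem extLeft_mem {s : Set α} (hq : q ∈ s) (ha : ∀ v ∈ A, a v ∈ s) (hb : ∀ v ∈ A, b v ∈ s) :
    extLeft G A q a b v ∈ s := by
  classical
  rw [extLeft]
  split_ifs with hv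
  · exact ha v hv
  · exact fold_mem (fun x hx y hy => min_rec' (· ∈ s) hx hy) hq fun w hw =>
      hb w (Finset.mem_filter.1 hw).1

theorem extRight_mem {s : Set α} (hq : q ∈ s) (ha : ∀ v ∈ A, a v ∈ s) (hb : ∀ v ∈ A, b v ∈ s) :
    extRight G A q a b v ∈ s := by
  classical
  rw [extRight]
  split_ifs with hv
  · exact hb v hv
  · exact fold_mem (fun x hx y hy => max_rec' (· ∈ s) hx hy) hq fun w hw =>
      ha w (Finset.mem_filter.1 hw).1

/-- The extended intervals are contained in the original ones, and they still meet where they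
should, since the interval of a vertex outside `A` reaches out to its neighbours in `A`. -/
theorem IsBoxModel.extend {l r : ι → V → α} {p : ι → α} (h : IsBoxModel G l r)
    (hp : ∀ i, ∀ v ∉ A, p i ∈ Set.Icc (l i v) (r i v)) :
    IsBoxModel G (fun i => extLeft G A (p i) (l i) (r i))
      (fun i => extRight G A (p i) (l i) (r i)) := by
  have hadj {u v} (huv : u = v ∨ G.Adj u v) i : l i u ≤ r i v := ((h u v).1 huv i).1
  have hl i v : l i v ≤ extLeft G A (p i) (l i) (r i) v := by
    by_cases hv : v ∈ A
    · rw [extLeft_of_mem hv]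
    · exact (le_extLeft_iff hv).2 ⟨(hp i v hv).1, fun w _ hvw => hadj (.inr hvw) i⟩
  have hr i v : extRight G A (p i) (l i) (r i) v ≤ r i v := by
    by_cases hv : v ∈ A
    · rw [extRight_of_mem hv]
    · exact (extRight_le_iff hv).2 ⟨(hp i v hv).2, fun w _ hvw => hadj (.inr hvw.symm) i⟩
  have hmeet {u v} (huv : u = v ∨ G.Adj u v) i :
      extLeft G A (p i) (l i) (r i) u ≤ extRight G A (p i) (l i) (r i) v := by
    by_cases hu : u ∈ A <;> by_cases hv : v ∈ A
    · rw [extLeft_of_mem hu, extRight_of_mem hv]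
      exact hadj huv i
    · rw [extLeft_of_mem hu]
      exact ((extRight_le_iff hv).1 le_rfl).2 u hu
        (huv.resolve_left (ne_of_mem_of_not_mem hu hv)).symm
    · rw [extRight_of_mem hv]
      exact ((le_extLeft_iff hu).1 le_rfl).2 v hv
        (huv.resolve_left (ne_of_mem_of_not_mem hv hu).symm)
    · exact ((le_extLeft_iff hu).1 le_rfl).1.trans ((extRight_le_iff hv).1 le_rfl).1
  refine fun u v => ⟨fun huv i => ⟨hmeet huv i, hmeet (huv.imp Eq.symm .symm) i⟩, fun hm => ?_⟩
  exact (h u v).2 fun i =>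
    ⟨(hl i u).trans ((hm i).1.trans (hr i v)), (hl i v).trans ((hm i).2.trans (hr i u))⟩

theorem exists_mem_Icc_of_forall_le [Nonempty α] {s : Set V} (hs : s.Finite) {l r : V → α}
    (h : ∀ u ∈ s, ∀ v ∈ s, l u ≤ r v) : ∃ p, ∀ v ∈ s, p ∈ Set.Icc (l v) (r v) := by
  rcases s.eq_empty_or_nonempty with rfl | hne
  · exact ⟨Classical.arbitrary α, by simp⟩
  · obtain ⟨u, hu, hmax⟩ := Set.exists_max_image s l hs hne
    exact ⟨l u, fun v hv => ⟨hmax v hv, h u hu v hv⟩⟩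

theorem IsBoxModel.exists_nat_extend [Finite V] [Nonempty α] (hA : G.IsClique (A : Set V)ᶜ)
    {l r : ι → V → α} (h : IsBoxModel G l r) :
    ∃ a b : ι → V → ℕ, (∀ i, ∀ v ∈ A, a i v ≤ 4 * A.card ∧ b i v ≤ 4 * A.card) ∧
      IsBoxModel G (fun i => extLeft G A (2 * A.card) (a i) (b i))
        (fun i => extRight G A (2 * A.card) (a i) (b i)) := by
  have hp i : ∃ p, ∀ v ∉ A, p ∈ Set.Icc (l i v) (r i v) :=
    exists_mem_Icc_of_forall_le (Set.toFinite (A : Set V)ᶜ) fun u hu v hv =>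
      ((h u v).1 (or_iff_not_imp_left.2 (hA hu hv)) i).1
  choose p hp using hp
  let E i : Finset α := A.image (l i) ∪ A.image (r i)
  have hE i : (E i).card ≤ 2 * A.card :=
    (Finset.card_union_le _ _).trans
      ((add_le_add Finset.card_image_le Finset.card_image_le).trans (two_mul _).ge)
  choose φ hmono hstrict hφp hφ using fun i => exists_monotone_nat (E i) (p i) (hE i)
  have hpE i : p i ∈ insert (p i) (E i) := Finset.mem_insert_self _ _
  have hlE i v (hv : v ∈ A) : l i v ∈ insert (p i) (E i) :=
    Finset.mem_insert_of_mem (Finset.mem_union_left _ (Finset.mem_image_of_mem _ hv))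
  have hrE i v (hv : v ∈ A) : r i v ∈ insert (p i) (E i) :=
    Finset.mem_insert_of_mem (Finset.mem_union_right _ (Finset.mem_image_of_mem _ hv))
  refine ⟨fun i => φ i ∘ l i, fun i => φ i ∘ r i, fun i v hv => ⟨?_, ?_⟩, ?_⟩
  · exact (hφ i _ (hlE i v hv)).trans_eq (by ring)
  · exact (hφ i _ (hrE i v hv)).trans_eq (by ring)
  · simpa only [map_extLeft (hmono _), map_extRight (hmono _), hφp] using
      (h.extend hp).map hstrict (fun i _ => extLeft_mem (hpE i) (hlE i) (hrE i))
        (fun i _ => extRight_mem (hpE i) (hlE i) (hrE i))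

end Extension

end Models

/-! ### Candidates -/

section Candidates

variable {V : Type*} [LinearOrder V] {G : SimpleGraph V} {A : Finset V} {d : ℕ}

/-- The left end point that the candidate `c` gives to the vertex `v ∈ A` in dimension `i`; it is
a digit of `c` to the base `4 |A| + 1`. -/
def leftDigit (A : Finset V) (c : ℕ) (i : Fin d) (v : V) : ℕ :=
  c / (4 * A.card + 1) ^ (rank A v + i * A.card) % (4 * A.card + 1)

/-- The right end point that the candidate `c` gives to the vertex `v ∈ A` in dimension `i`; the
digits for the right end points come after the `d |A|` digits for the left ones. -/
def rightDigit (A : Finset V) (c : ℕ) (i : Fin d) (v : V) : ℕ :=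
  c / (4 * A.card + 1) ^ (rank A v + i * A.card + d * A.card) % (4 * A.card + 1)

/-- The left end points of the intervals that belong to the candidate `c`. -/
noncomputable def candLeft (G : SimpleGraph V) (A : Finset V) (c : ℕ) (i : Fin d) : V → ℕ :=
  extLeft G A (2 * A.card) (leftDigit A c i) (rightDigit A c i)

/-- The right end points of the intervals that belong to the candidate `c`. -/
noncomputable def candRight (G : SimpleGraph V) (A : Finset V) (c : ℕ) (i : Fin d) : V → ℕ :=
  extRight G A (2 * A.card) (leftDigit A c i) (rightDigit A c i)

/-- The intervals that belong to the candidate `c` form a box representation of dimension `d`. -/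
def IsBoxCandidate (G : SimpleGraph V) (A : Finset V) (d c : ℕ) : Prop :=
  IsBoxModel G (fun i : Fin d => candLeft G A c i) fun i => candRight G A c i

/-- The elements of `A` are numbered by their ranks. -/
noncomputable def rankEquiv (A : Finset V) : A ≃ Fin A.card :=
  .ofBijective (fun v => ⟨rank A v, rank_lt_card v.2⟩)
    ((Fintype.bijective_iff_injective_and_card _).2
      ⟨fun u v h => Subtype.ext ((rank_strictMonoOn A).injOn u.2 v.2 (congrArg Fin.val h)),
        by simp⟩)

theorem exists_digits {B N : ℕ} (f : Fin N → Fin B) :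
    ∃ c < B ^ N, ∀ t : Fin N, c / B ^ (t : ℕ) % B = f t := by
  refine ⟨finFunctionFinEquiv f, (finFunctionFinEquiv f).2, fun t => ?_⟩
  rw [← finFunctionFinEquiv_symm_apply_val, Equiv.symm_apply_apply]

theorem exists_candidate_digits {a b : Fin d → V → ℕ}
    (hab : ∀ i, ∀ v ∈ A, a i v ≤ 4 * A.card ∧ b i v ≤ 4 * A.card) :
    ∃ c < (4 * A.card + 1) ^ (d * A.card + d * A.card), ∀ i, ∀ v ∈ A,
      leftDigit A c i v = a i v ∧ rightDigit A c i v = b i v := by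
  let e := rankEquiv A
  obtain ⟨c, hc, hdigit⟩ := exists_digits (B := 4 * A.card + 1)
    (Sum.elim (fun x : Fin (d * A.card) =>
        ⟨a x.divNat (e.symm x.modNat), Nat.lt_succ_of_le (hab _ _ (e.symm x.modNat).2).1⟩)
      (fun x : Fin (d * A.card) =>
        ⟨b x.divNat (e.symm x.modNat), Nat.lt_succ_of_le (hab _ _ (e.symm x.modNat).2).2⟩) ∘
      finSumFinEquiv.symm)
  refine ⟨c, hc, fun i v hv => ?_⟩
  let x : Fin (d * A.card) := finProdFinEquiv (i, e ⟨v, hv⟩)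
  have hx : (x.divNat, x.modNat) = (i, e ⟨v, hv⟩) := finProdFinEquiv.symm_apply_apply _
  have hval : (x : ℕ) = rank A v + i * A.card := by
    simp [x, e, rankEquiv, mul_comm]
  rw [Prod.mk.injEq] at hx
  constructor
  · simpa [leftDigit, hx, hval] using hdigit (finSumFinEquiv (.inl x))
  · simpa [rightDigit, hx, hval, add_comm (d * A.card), -Fin.natAdd_eq_addNat]
      using hdigit (finSumFinEquiv (.inr x))

theorem exists_candidate [Finite V] (hA : G.IsClique (A : Set V)ᶜ) (hd : HasBoxRep G d) :
    ∃ c < (4 * A.card + 1) ^ (d * A.card + d * A.card), IsBoxCandidate G A d c := by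
  obtain ⟨l, r, h⟩ := hd
  obtain ⟨a, b, hab, hmodel⟩ := (isBoxRep_iff_isBoxModel.1 h).exists_nat_extend hA
  obtain ⟨c, hc, hdigit⟩ := exists_candidate_digits hab
  refine ⟨c, hc, ?_⟩
  have hl (i : Fin d) : candLeft G A c i = extLeft G A (2 * A.card) (a i) (b i) :=
    extLeft_congr fun v hv => hdigit i v hv
  have hr (i : Fin d) : candRight G A c i = extRight G A (2 * A.card) (a i) (b i) :=
    extRight_congr fun v hv => hdigit i v hv
  simpa only [IsBoxCandidate, hl, hr] using hmodel

end Candidates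

/-! ### Sums that count -/

theorem lt_sum_range_ite_iff {p : ℕ → Prop} [DecidablePred p] (hp : ∀ t, p (t + 1) → p t)
    {N t : ℕ} : (t < ∑ t ∈ Finset.range N, if p t then 1 else 0) ↔ t < N ∧ p t := by
  have hp' := antitone_nat_of_succ_le (f := p) hp
  induction N with
  | zero => simp
  | succ N ih =>
    rw [Finset.sum_range_succ]
    by_cases hN : p N
    · have hall : (∑ t ∈ Finset.range N, if p t then 1 else 0) = N := by
        rw [Finset.sum_congr rfl fun t ht =>
          if_pos (hp' (Finset.mem_range.1 ht).le hN)]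
        simp
      rw [if_pos hN, hall]
      exact ⟨fun h => ⟨h, hp' (Nat.le_of_lt_succ h) hN⟩, And.left⟩
    · rw [if_neg hN, add_zero]
      refine ih.trans ⟨fun h => ⟨h.1.trans (Nat.lt_succ_self N), h.2⟩, fun h => ⟨?_, h.2⟩⟩
      exact (Nat.lt_succ_iff_lt_or_eq.1 h.1).resolve_right fun heq => hN (heq ▸ h.2)

theorem sum_range_ite_mul_le (c : ℕ) {P : ℕ} (hP : 0 < P) :
    (∑ j ∈ Finset.range c, if (j + 1) * P ≤ c then 1 else 0) = c / P := by
  refine eq_of_forall_lt_iff fun t => ?_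
  rw [lt_sum_range_ite_iff fun t h => (Nat.mul_le_mul_right P (Nat.le_succ _)).trans h,
    ← Nat.le_div_iff_mul_le hP]
  exact ⟨And.right, fun h => ⟨h.trans_le (Nat.div_le_self c P), h⟩⟩

theorem sum_range_ite_mem {n : ℕ} (A : Finset (Fin n)) (k : ℕ) :
    (∑ w ∈ Finset.range k, if ∃ v ∈ A, (v : ℕ) = w then 1 else 0) =
      (A.filter fun v : Fin n => (v : ℕ) < k).card := by
  classical
  rw [← Finset.card_filter, ← Finset.card_map Fin.valEmbedding]
  congr 1
  ext w
  simp only [Finset.mem_filter, Finset.mem_range, Finset.mem_map, Fin.valEmbedding_apply]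
  grind

/-! ### The algorithm -/

namespace Reg

/-- The number `n` of vertices and, at the end, the boxicity. -/
@[simp] abbrev size : ℕ := 0

/-- The number `m` of marked vertices. -/
@[simp] abbrev marked : ℕ := 1

/-- The base `4 m + 1` of the digits of a candidate. -/
@[simp] abbrev base : ℕ := 2

/-- The dimension that is being tried. -/
@[simp] abbrev dim : ℕ := 3

/-- The candidate that is being tried. -/
@[simp] abbrev cand : ℕ := 4

/-- The first counter of a two-dimensional loop. -/
@[simp] abbrev row : ℕ := 5

/-- The second counter of a two-dimensional loop. -/
@[simp] abbrev col : ℕ := 6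

/-- The auxiliary variable of case distinctions. -/
@[simp] abbrev once : ℕ := 7

/-- The truth value of a box representation having been found. -/
@[simp] abbrev found : ℕ := 8

/-- The dimension of the last candidate that has been tried. -/
@[simp] abbrev result : ℕ := 9

/-- The `k`-th variable that is bound by a sum. -/
@[simp] abbrev bound (k : ℕ) : ℕ := 10 + k

end Reg

namespace Arr

/-- The adjacency matrix. -/
@[simp] abbrev adj : ℕ := 0

/-- The left end points of the intervals of all vertices. -/
@[simp] abbrev left : ℕ := 1

/-- The right end points of the intervals of all vertices. -/
@[simp] abbrev right : ℕ := 2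

/-- The left end points of the intervals of the marked vertices. -/
@[simp] abbrev leftDigit : ℕ := 3

/-- The right end points of the intervals of the marked vertices. -/
@[simp] abbrev rightDigit : ℕ := 4

/-- The truth values of the vertices being marked. -/
@[simp] abbrev mark : ℕ := 5

/-- The table of the multiples of `n`. -/
@[simp] abbrev mult : ℕ := 6

/-- The table of the powers of the base. -/
@[simp] abbrev pow : ℕ := 7

end Arr

namespace Term

/-- The truth value of two vertices being adjacent. Multiples of `n` are looked up in a table, since
their computation would take time `n`. -/
def adj (u v : Term) : Term := get Arr.adj (add (get Arr.mult u) v)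

/-- The index `i * n + v`, computed with the `k`-th bound variable. -/
def index (k : ℕ) (i v : Term) : Term := add (mul (Reg.bound k) i (var Reg.size)) v

/-- The quotient of the candidate by the power of the base with exponent `t`, as the number of
positive multiples of the power up to the candidate. -/
def quot (t : Term) : Term :=
  sum .trials (Reg.bound 0) (var Reg.cand)
    (le (mul (Reg.bound 1) (add (var (Reg.bound 0)) (const 1)) (get Arr.pow t)) (var Reg.cand))

/-- The digit of the candidate at the position `t`. -/
def digit (t : Term) : Term :=
  sub (quot t) (mul (Reg.bound 0) (quot (add t (const 1))) (var Reg.base))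

/-- The position of the digit for a left end point. -/
def leftPos : Term :=
  add (sum .vertices (Reg.bound 2) (var Reg.col) (get Arr.mark (var (Reg.bound 2))))
    (mul (Reg.bound 2) (var Reg.row) (var Reg.marked))

/-- The position of the digit for a right end point. -/
def rightPos : Term := add leftPos (mul (Reg.bound 2) (var Reg.dim) (var Reg.marked))

/-- The truth value of the bound variable `2` being a marked neighbour of the current vertex. -/
def markedNeighbor : Term :=
  and (get Arr.mark (var (Reg.bound 2))) (adj (var Reg.col) (var (Reg.bound 2)))

/-- The left end point of the interval of a vertex. -/
def leftEnd : Term :=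
  ite (Reg.bound 0) (get Arr.mark (var Reg.col))
    (get Arr.leftDigit (index 1 (var Reg.row) (var Reg.col)))
    (sum .trials (Reg.bound 1) (add (var Reg.marked) (var Reg.marked))
      (all .vertices (Reg.bound 2) (var Reg.size)
        (imp markedNeighbor (lt (var (Reg.bound 1))
          (get Arr.rightDigit (index 3 (var Reg.row) (var (Reg.bound 2))))))))

/-- The right end point of the interval of a vertex. -/
def rightEnd : Term :=
  ite (Reg.bound 0) (get Arr.mark (var Reg.col))
    (get Arr.rightDigit (index 1 (var Reg.row) (var Reg.col)))
    (sum .trials (Reg.bound 1) (var Reg.base)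
      (or (lt (var (Reg.bound 1)) (add (var Reg.marked) (var Reg.marked)))
        (any .vertices (Reg.bound 2) (var Reg.size)
          (and markedNeighbor (lt (var (Reg.bound 1))
            (get Arr.leftDigit (index 3 (var Reg.row) (var (Reg.bound 2)))))))))

/-- The truth value of the left end point of the vertex `u` being at most the right end point of
the vertex `v`. -/
def leftLeRight (u v : Term) : Term :=
  le (get Arr.left (index 3 (var (Reg.bound 2)) u)) (get Arr.right (index 3 (var (Reg.bound 2)) v))

/-- The truth value of the intervals forming a box representation. -/
def isBoxModel : Term :=
  all .vertices (Reg.bound 0) (var Reg.size) (all .vertices (Reg.bound 1) (var Reg.size)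
    (eq (or (eq (var (Reg.bound 0)) (var (Reg.bound 1)))
        (adj (var (Reg.bound 0)) (var (Reg.bound 1))))
      (all .trials (Reg.bound 2) (var Reg.dim)
        (and (leftLeRight (var (Reg.bound 0)) (var (Reg.bound 1)))
          (leftLeRight (var (Reg.bound 1)) (var (Reg.bound 0)))))))

end Term

namespace Cmd

open Term

/-- The two-dimensional loop with `e` rows and one column for each vertex. -/
def grid (b : Extent) (e : Term) (p : Cmd) : Cmd :=
  loop b Reg.row e (loop .vertices Reg.col (var Reg.size) p)

/-- Tabulate the multiples of `n`. -/
def tabulateMult : Cmd :=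
  loop .vertices Reg.row (var Reg.size)
    (put Arr.mult (var Reg.row) (sum .vertices (Reg.bound 0) (var Reg.row) (var Reg.size)))

/-- Mark the vertices of a maximal matching in the complement of the graph. -/
def markMatching : Cmd :=
  grid .vertices (var Reg.size)
    (when Reg.once
      (and (not (or (get Arr.mark (var Reg.row)) (get Arr.mark (var Reg.col))))
        (not (or (eq (var Reg.row) (var Reg.col)) (adj (var Reg.row) (var Reg.col)))))
      (seq (put Arr.mark (var Reg.row) (const 1)) (put Arr.mark (var Reg.col) (const 1))))

/-- Count the marked vertices. -/
def countMarked : Cmd :=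
  seq (set Reg.marked
      (sum .vertices (Reg.bound 0) (var Reg.size) (get Arr.mark (var (Reg.bound 0)))))
    (set Reg.base (add (add (add (var Reg.marked) (var Reg.marked))
      (add (var Reg.marked) (var Reg.marked))) (const 1)))

/-- Tabulate the powers of the base. -/
def tabulatePow : Cmd :=
  seq (put Arr.pow (const 0) (const 1))
    (loop .trials Reg.row
      (mul (Reg.bound 0) (add (var Reg.marked) (const 1)) (add (var Reg.marked) (var Reg.marked)))
      (put Arr.pow (add (var Reg.row) (const 1))
        (mul (Reg.bound 0) (var Reg.base) (get Arr.pow (var Reg.row)))))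

/-- Store the values of `e` for all dimensions and vertices in the array `a`. -/
def tabulate (a : ℕ) (e : Term) : Cmd :=
  grid .trials (var Reg.dim) (put a (index 0 (var Reg.row) (var Reg.col)) e)

/-- Try a candidate. -/
def tryCandidate : Cmd :=
  seq (tabulate Arr.leftDigit (digit leftPos)) (seq (tabulate Arr.rightDigit (digit rightPos))
    (seq (tabulate Arr.left leftEnd) (seq (tabulate Arr.right rightEnd)
      (seq (set Reg.found isBoxModel) (set Reg.result (var Reg.dim))))))

/-- Try all candidates in all dimensions, until a box representation has been found. -/
def search : Cmd :=
  loop .trials Reg.dim (add (var Reg.marked) (const 1))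
    (loop .trials Reg.cand
      (get Arr.pow (mul (Reg.bound 0) (var Reg.dim) (add (var Reg.marked) (var Reg.marked))))
      (when Reg.once (not (var Reg.found)) tryCandidate))

/-- Compute an optimal box representation. -/
def box : Cmd :=
  seq tabulateMult (seq markMatching (seq countMarked (seq tabulatePow
    (seq search (set Reg.size (var Reg.result))))))

theorem box_inScope : box.inScope 10 = true := by decide

theorem deg_box : box.deg .vertices = 2 := by decide

end Cmd

/-! ### Correctness of the preparations -/

theorem index_lt {n d : ℕ} (i : Fin d) (v : Fin n) : i * n + v < d * n := by
  simpa [mul_comm, add_comm] using (finProdFinEquiv (i, v)).2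

theorem index_inj {n i j : ℕ} {u v : Fin n} : i * n + u = j * n + v ↔ i = j ∧ u = v := by
  refine ⟨fun h => ?_, by rintro ⟨rfl, rfl⟩; rfl⟩
  have hdiv := congrArg (· / n) h
  have hmod := congrArg (· % n) h
  have hn : 0 < n := u.pos
  simp only [mul_comm _ n, Nat.mul_add_div hn, Nat.div_eq_of_lt u.2, Nat.div_eq_of_lt v.2,
    Nat.mul_add_mod, Nat.mod_eq_of_lt u.2, Nat.mod_eq_of_lt v.2] at hdiv hmod
  exact ⟨hdiv, Fin.ext hmod⟩

namespace Store

theorem setArr_arr (s : Store) (a i v b j : ℕ) :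
    (s.setArr a i v).arr b j = if b = a ∧ j = i then v else s.arr b j := by
  by_cases h : b = a
  · subst h
    simp [setArr, Function.update_apply]
  · simp [setArr, h]

theorem setArr_arr_of_ne (s : Store) {a b : ℕ} (h : b ≠ a) (i v : ℕ) :
    (s.setArr a i v).arr b = s.arr b := by
  simp [setArr, h]

end Store

section Grid

variable {n W d : ℕ} {s : Store}

theorem Term.HasValue.index {k i v : ℕ} {e f : Term} (hn : s.reg Reg.size = n)
    (he : e.HasValue n W s i) (hi : i ≤ W) (hf : f.HasValue n W s v) :
    (index k e f).HasValue n W s (i * n + v) :=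
  (he.mul hi fun _ _ => .var (by
    rw [Store.setReg_reg, if_neg (by simp only [Reg.size, Reg.bound]; omega), hn])).add hf

theorem Cmd.Ok.grid {b : Extent} {e : Term} {p : Cmd} (I : ℕ → Store → Prop)
    (hn : ∀ t s', I t s' → s'.reg Reg.size = n)
    (hrow : ∀ t s' i, I t s' → I t (s'.setReg Reg.row i))
    (hcol : ∀ t s' v, I t s' → I t (s'.setReg Reg.col v))
    (he : e.HasValue n W s d) (hd : d ≤ b.eval n W) (h0 : I 0 s)
    (step : ∀ (i : Fin d) (v : Fin n) s', I (i * n + v) s' → s'.reg Reg.row = i →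
      s'.reg Reg.col = v →
      p.Ok n W s' fun s'' => I (i * n + v + 1) s'' ∧ s''.reg Reg.row = i) :
    (Cmd.grid b e p).Ok n W s (I (d * n)) := by
  refine .loop (fun i s' => I (i * n) s') he hd (by simpa using h0) fun i hi s₁ h₁ => ?_
  refine .mono (.loop (fun v s' => I (i * n + v) s' ∧ s'.reg Reg.row = i)
    (.var (hn _ _ (hrow _ _ i h₁))) le_rfl ⟨hrow _ _ i h₁, by simp⟩ fun v hv s₂ h₂ => ?_)
    fun s₂ h₂ => by simpa only [Nat.succ_mul] using h₂.1
  exact step ⟨i, hi⟩ ⟨v, hv⟩ _ (hcol _ _ v h₂.1) (by simpa using h₂.2) (by simp)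

end Grid

section Preparations

variable {n W : ℕ} {G : SimpleGraph (Fin n)} {A : Finset (Fin n)} {s : Store}

open Classical in
/-- The store holds `n` and the adjacency matrix of `G`. -/
structure HoldsGraph (G : SimpleGraph (Fin n)) (s : Store) : Prop where
  size : s.reg Reg.size = n
  adj : ∀ u v : Fin n, s.arr Arr.adj (u * n + v) = if G.Adj u v then 1 else 0

/-- The store holds `G` and the multiples of `n`. -/
structure Prepared (G : SimpleGraph (Fin n)) (s : Store) : Prop extends HoldsGraph G s where
  mult : ∀ u : Fin n, s.arr Arr.mult u = u * n

/-- The marked vertices are those in `A`. -/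
def Marks (A : Finset (Fin n)) (s : Store) : Prop :=
  ∀ v : Fin n, s.arr Arr.mark v = if v ∈ A then 1 else 0

theorem holdsGraph_inputStore (G : SimpleGraph (Fin n)) : HoldsGraph G (inputStore G) where
  size := rfl
  adj u v := by
    have : (∃ u' v' : Fin n, G.Adj u' v' ∧ (u : ℕ) * n + v = u' * n + v') ↔ G.Adj u v := by
      simp [index_inj, ← Fin.ext_iff, and_comm]
    classical exact if_congr ((and_iff_right rfl).trans this) rfl rfl

theorem HoldsGraph.congr {s' : Store} (h : HoldsGraph G s)
    (hreg : s'.reg Reg.size = s.reg Reg.size) (harr : s'.arr Arr.adj = s.arr Arr.adj) :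
    HoldsGraph G s' :=
  ⟨hreg ▸ h.size, harr ▸ h.adj⟩

namespace Prepared

theorem congr {s' : Store} (h : Prepared G s) (hreg : s'.reg Reg.size = s.reg Reg.size)
    (hadj : s'.arr Arr.adj = s.arr Arr.adj) (hmult : s'.arr Arr.mult = s.arr Arr.mult) :
    Prepared G s' :=
  ⟨h.toHoldsGraph.congr hreg hadj, hmult ▸ h.mult⟩

theorem setReg (h : Prepared G s) {x : ℕ} (hx : 0 < x) (v : ℕ) : Prepared G (s.setReg x v) :=
  h.congr (by simp [hx.ne]) rfl rfl

theorem setArr (h : Prepared G s) {a : ℕ} (ha : Arr.adj ≠ a) (ha' : Arr.mult ≠ a) (i v : ℕ) :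
    Prepared G (s.setArr a i v) :=
  h.congr rfl (s.setArr_arr_of_ne ha i v) (s.setArr_arr_of_ne ha' i v)

theorem decides_adj (h : Prepared G s) {u v : Fin n} {e f : Term} (he : e.HasValue n W s u)
    (hf : f.HasValue n W s v) : (Term.adj e f).Decides n W s (G.Adj u v) :=
  .get (.add (.get he (h.mult u)) hf) (h.adj u v)

end Prepared

theorem tabulateMult_ok (hs : HoldsGraph G s) (hA : Marks A s) (hfound : s.reg Reg.found = 0) :
    Cmd.tabulateMult.Ok n W s fun s' => Prepared G s' ∧ Marks A s' ∧ s'.reg Reg.found = 0 := by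
  refine .mono (.loop (fun i s' => (HoldsGraph G s' ∧ ∀ u : Fin n, u < i →
    s'.arr Arr.mult u = u * n) ∧ Marks A s' ∧ s'.reg Reg.found = 0) (.var hs.size) le_rfl
    ⟨⟨hs, fun u hu => absurd hu (Nat.not_lt_zero _)⟩, hA, hfound⟩ ?_)
    fun s' ⟨⟨hs', hmult⟩, h⟩ => ⟨⟨hs', fun u => hmult u u.2⟩, h⟩
  rintro i hi s' ⟨⟨hs', hmult⟩, hA', hzero⟩
  have hval : (Term.sum .vertices (Reg.bound 0) (.var Reg.row) (.var Reg.size)).HasValue n W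
      (s'.setReg Reg.row i) (i * n) := by
    simpa using Term.HasValue.sum (b := .vertices) (x := Reg.bound 0) (v := i) (g := fun _ => n)
      (.var (by simp)) hi.le fun j _ => .var (by simp [hs'.size])
  have hrow : (Term.var Reg.row).HasValue n W (s'.setReg Reg.row i) i := .var (by simp)
  refine .put hrow hval ⟨⟨hs'.congr (by simp) rfl, fun u hu => ?_⟩, ?_, ?_⟩
  · rw [Store.setArr_arr]
    split_ifs with h
    · rw [h.2]
    · exact hmult u (by simp at h; omega)
  · exact hA'
  · simpa using hzero

/-- Every clique misses at least half of `A`. -/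
def HalfFree {V : Type*} [DecidableEq V] (G : SimpleGraph V) (A : Finset V) : Prop :=
  ∀ S : Finset V, G.IsClique (S : Set V) → A.card ≤ 2 * (A \ S).card

namespace HalfFree

variable {V : Type*} [DecidableEq V] {G : SimpleGraph V} {A : Finset V} {u v : V}

theorem insert_pair (h : HalfFree G A) (hu : u ∉ A) (hv : v ∉ A) (huv : u ≠ v)
    (hadj : ¬ G.Adj u v) : HalfFree G (insert u (insert v A)) := by
  intro S hS
  have h₁ := h S hS
  rw [Finset.card_insert_of_notMem (by simp [huv, hu]), Finset.card_insert_of_notMem hv]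
  suffices (A \ S).card + 1 ≤ (insert u (insert v A) \ S).card by omega
  obtain ⟨w, hw, hwA, hwS⟩ : ∃ w, w ∈ insert u (insert v A) ∧ w ∉ A ∧ w ∉ S := by
    by_contra! hc
    exact hadj (hS (hc u (by simp) hu) (hc v (by simp) hv) huv)
  rw [← Finset.card_insert_of_notMem (a := w) (s := A \ S) (by simp [hwA])]
  refine Finset.card_le_card (Finset.insert_subset (Finset.mem_sdiff.2 ⟨hw, hwS⟩)
    (Finset.sdiff_subset_sdiff ?_ le_rfl))
  exact (Finset.subset_insert v A).trans (Finset.subset_insert u _)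

theorem card_le [Fintype V] {k : ℕ} (h : HalfFree G A) {S : Finset V}
    (hS : G.IsClique (S : Set V)) (hk : Fintype.card V ≤ S.card + k) : A.card ≤ 2 * k := by
  have h₁ := h S hS
  have h₂ : (A \ S).card ≤ Sᶜ.card :=
    Finset.card_le_card fun v hv => Finset.mem_compl.2 (Finset.mem_sdiff.1 hv).2
  have h₃ := S.card_add_card_compl
  omega

end HalfFree

namespace Marks

theorem insert (hA : Marks A s) (u : Fin n) : Marks (insert u A) (s.setArr Arr.mark u 1) := by
  intro v
  simp only [Store.setArr_arr, Finset.mem_insert, true_and, Fin.val_inj, hA v]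
  split_ifs <;> first | rfl | tauto

theorem decides (hA : Marks A s) {v : Fin n} {e : Term} (he : e.HasValue n W s v) :
    (Term.get Arr.mark e).Decides n W s (v ∈ A) :=
  he.get (by rw [hA]; congr)

end Marks

/-- The pairs of vertices with indices below `t` are compatible with `A` being the complement of
a clique. -/
def CliqueBelow (G : SimpleGraph (Fin n)) (A : Finset (Fin n)) (t : ℕ) : Prop :=
  ∀ u v : Fin n, u * n + v < t → u ∉ A → v ∉ A → u ≠ v → G.Adj u v

theorem CliqueBelow.succ {B : Finset (Fin n)} {u v : Fin n} (h : CliqueBelow G A (u * n + v))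
    (hAB : A ⊆ B) (huv : u ∉ B → v ∉ B → u ≠ v → G.Adj u v) :
    CliqueBelow G B (u * n + v + 1) := by
  intro u' v' hlt hu hv hne
  rcases Nat.lt_succ_iff_lt_or_eq.1 hlt with hlt | heq
  · exact h u' v' hlt (mt (@hAB _) hu) (mt (@hAB _) hv) hne
  · obtain ⟨huu', rfl⟩ := index_inj.1 heq
    obtain rfl := Fin.ext huu'
    exact huv hu hv hne

theorem markMatching_ok (hW : 0 < W) (hs : Prepared G s) (h0 : Marks (∅ : Finset (Fin n)) s)
    (hfound : s.reg Reg.found = 0) :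
    Cmd.markMatching.Ok n W s fun s' => ∃ A : Finset (Fin n), HalfFree G A ∧
      G.IsClique (A : Set (Fin n))ᶜ ∧ Prepared G s' ∧ Marks A s' ∧ s'.reg Reg.found = 0 := by
  let I (t : ℕ) (s' : Store) : Prop := (Prepared G s' ∧ s'.reg Reg.found = 0) ∧
    ∃ A : Finset (Fin n), Marks A s' ∧ HalfFree G A ∧ CliqueBelow G A t
  have hI t s' (x v : ℕ) (h : I t s') (hx : 0 < x) (hx' : Reg.found ≠ x) : I t (s'.setReg x v) :=
    ⟨⟨h.1.1.setReg hx v, by simpa [hx'] using h.1.2⟩, h.2⟩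
  refine .mono (.grid I (fun t s' h => h.1.1.size) (fun t s' i h => hI t s' _ i h (by decide)
    (by decide)) (fun t s' i h => hI t s' _ i h (by decide) (by decide)) (.var hs.size) le_rfl
    ⟨⟨hs, hfound⟩, ∅, h0, fun S _ => by simp,
      fun u v h => absurd h (Nat.not_lt_zero _)⟩ ?_)
    fun s' ⟨⟨hs', hzero⟩, A, hA, hhalf, hclique⟩ => ⟨A, hhalf, fun u hu v hv huv =>
      hclique u v (index_lt u v) hu hv huv, hs', hA, hzero⟩
  rintro u v s' ⟨⟨hs', hzero⟩, A, hA, hhalf, hclique⟩ hu hv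
  have hu' : (Term.var Reg.row).HasValue n W s' u := .var hu
  have hv' : (Term.var Reg.col).HasValue n W s' v := .var hv
  have htest := (((hA.decides hu').or (hA.decides hv')).not.and
    (((Term.Decides.eq hu' hv').congr Fin.val_inj).or (hs'.decides_adj hu' hv')).not)
  refine .when hW htest (fun ⟨hmark, hedge⟩ => ?_) fun htest' =>
    ⟨⟨⟨hs', hzero⟩, A, hA, hhalf,
      hclique.succ le_rfl fun h₁ h₂ h₃ => by tauto⟩, hu⟩
  rw [not_or] at hmark hedge
  refine .seq (R := fun s'' => s'' = _) (.put (u := u) (.var (by simpa using hu)) (.const 1) rfl) ?_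
  rintro _ rfl
  refine .put (u := v) (.var (by simpa using hv)) (.const 1) ⟨⟨⟨?_, ?_⟩, insert v (insert u A),
    (hA.insert u).insert v, Finset.insert_comm u v A ▸
      hhalf.insert_pair hmark.1 hmark.2 hedge.1 hedge.2, hclique.succ ?_ ?_⟩, ?_⟩
  · exact ((hs'.setReg (by decide) 0).setArr (by decide) (by decide) _ _).setArr (by decide)
      (by decide) _ _
  · simpa using hzero
  · exact (Finset.subset_insert u A).trans (Finset.subset_insert v _)
  · simp
  · simpa using hu

/-- The store holds `G`, the set `A` and the numbers that depend on the size of `A` only. -/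
structure Counted (G : SimpleGraph (Fin n)) (A : Finset (Fin n)) (s : Store) : Prop
    extends Prepared G s where
  marks : Marks A s
  card : s.reg Reg.marked = A.card
  base : s.reg Reg.base = 4 * A.card + 1

/-- The store also holds the powers of the base. -/
structure Ready (G : SimpleGraph (Fin n)) (A : Finset (Fin n)) (s : Store) : Prop
    extends Counted G A s where
  pow : ∀ t ≤ (A.card + 1) * (A.card + A.card), s.arr Arr.pow t = (4 * A.card + 1) ^ t

/-- The number `W` bounds all numbers of rounds that depend on the number `m` of marked vertices
only. -/
structure Ample (m W : ℕ) : Prop where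
  base : 4 * m + 1 ≤ W
  exponent : (m + 1) * (m + m) ≤ W
  pow : ∀ t ≤ (m + 1) * (m + m), (4 * m + 1) ^ t ≤ W

theorem Counted.setArr (h : Counted G A s) {a : ℕ} (ha : Arr.adj ≠ a) (ha' : Arr.mult ≠ a)
    (ha'' : Arr.mark ≠ a) (i v : ℕ) : Counted G A (s.setArr a i v) :=
  ⟨h.toPrepared.setArr ha ha' i v, fun u => by rw [s.setArr_arr_of_ne ha'', h.marks u],
    h.card, h.base⟩

theorem Counted.setReg (h : Counted G A s) {x : ℕ} (hx : 2 < x) (v : ℕ) :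
    Counted G A (s.setReg x v) :=
  ⟨h.toPrepared.setReg (by omega) v, h.marks,
    by rw [Store.setReg_reg, if_neg (by simp only [Reg.marked]; omega), h.card],
    by rw [Store.setReg_reg, if_neg (by simp only [Reg.base]; omega), h.base]⟩

theorem countMarked_ok (hs : Prepared G s) (hA : Marks A s) (hfound : s.reg Reg.found = 0) :
    Cmd.countMarked.Ok n W s fun s' => Counted G A s' ∧ s'.reg Reg.found = 0 := by
  have hcard : (Term.sum .vertices (Reg.bound 0) (.var Reg.size)
      (.get Arr.mark (.var (Reg.bound 0)))).HasValue n W s A.card := by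
    have hmark i : (Term.get Arr.mark (.var (Reg.bound 0))).HasValue n W
        (s.setReg (Reg.bound 0) i) (s.arr Arr.mark i) := .get (u := i) (.var (by simp)) rfl
    have h := Term.HasValue.sum (b := .vertices) (.var hs.size) le_rfl fun i _ => hmark i
    rw [Finset.sum_range, Finset.sum_congr rfl fun v _ => hA v] at h
    simpa using h
  refine .seq (R := fun s' => s' = _) (.set hcard rfl) ?_
  rintro _ rfl
  have hm : (Term.var Reg.marked).HasValue n W (s.setReg Reg.marked A.card) A.card := .var (by simp)
  refine .set (((hm.add hm).add (hm.add hm)).add (.const 1))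
    ⟨⟨(hs.setReg (by decide) _).setReg (by decide) _, hA, ?_, ?_⟩, ?_⟩
  · simp
  · simp only [Store.setReg_reg, if_true]
    ring
  · simpa using hfound

theorem Counted.tabulatePow_ok (hs : Counted G A s) (hW : Ample A.card W)
    (hfound : s.reg Reg.found = 0) :
    Cmd.tabulatePow.Ok n W s fun s' => Ready G A s' ∧ s'.reg Reg.found = 0 := by
  refine .seq (R := fun s' => s' = _) (.put (.const 0) (.const 1) rfl) ?_
  rintro _ rfl
  refine .mono (.loop (fun i s' => (Counted G A s' ∧ s'.reg Reg.found = 0) ∧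
    ∀ t ≤ i, s'.arr Arr.pow t = (4 * A.card + 1) ^ t)
    (.mul (.add (.var hs.card) (.const 1)) (by linarith [hW.base]) fun i _ =>
      .add (.var (by simpa using hs.card)) (.var (by simpa using hs.card))) hW.exponent
    ⟨⟨hs.setArr (by decide) (by decide) (by decide) _ _, hfound⟩, ?_⟩ ?_)
    fun s' h => ⟨⟨h.1.1, h.2⟩, h.1.2⟩
  · rintro _ ⟨⟩
    simp [Store.setArr_arr]
  · rintro i - s' ⟨⟨hs', hfound'⟩, hpow⟩
    have hrow : (Term.var Reg.row).HasValue n W (s'.setReg Reg.row i) i := .var (by simp)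
    refine .put (hrow.add (.const 1)) (.mul (v := (4 * A.card + 1) ^ i)
      (.var (by simpa using hs'.base)) hW.base fun j _ => .get (v := _) (u := i)
        (.var (by simp)) (hpow i le_rfl))
      ⟨⟨(hs'.setReg (by decide) _).setArr (by decide) (by decide) (by decide) _ _,
        by simpa using hfound'⟩, fun t ht => ?_⟩
    rw [Store.setArr_arr]
    split_ifs with h
    · rw [h.2, pow_succ']
    · exact hpow t (by simp at h; omega)

end Preparations

/-! ### Correctness of the search -/

/-- The stores agree, except for the counters of two-dimensional loops and the array `a`. -/
structure Agree (a : ℕ) (s s' : Store) : Prop where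
  reg : ∀ y, y ≠ Reg.row → y ≠ Reg.col → s'.reg y = s.reg y
  arr : ∀ b, b ≠ a → s'.arr b = s.arr b

theorem Agree.refl (a : ℕ) (s : Store) : Agree a s s :=
  ⟨fun _ _ _ => rfl, fun _ _ => rfl⟩

theorem Agree.setReg {a : ℕ} {s s' : Store} (h : Agree a s s') {x : ℕ}
    (hx : x = Reg.row ∨ x = Reg.col) (v : ℕ) : Agree a s (s'.setReg x v) :=
  ⟨fun y hrow hcol => by rw [Store.setReg_reg, if_neg (by omega), h.reg y hrow hcol], h.arr⟩

theorem Agree.setArr {a : ℕ} {s s' : Store} (h : Agree a s s') (i v : ℕ) :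
    Agree a s (s'.setArr a i v) :=
  ⟨h.reg, fun b hb => by rw [s'.setArr_arr_of_ne hb, h.arr b hb]⟩

section Trial

variable {n W d c : ℕ} {G : SimpleGraph (Fin n)} {A : Finset (Fin n)} {s s' : Store}
  {a b : Fin d → Fin n → ℕ} {i : Fin d} {v : Fin n}

theorem Ready.setReg (h : Ready G A s) {x : ℕ} (hx : 2 < x) (v : ℕ) : Ready G A (s.setReg x v) :=
  ⟨h.toCounted.setReg hx v, h.pow⟩

theorem Ready.agree (h : Ready G A s) {x : ℕ} (h' : Agree x s s') (hx : 0 < x ∧ x < 5) :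
    Ready G A s' where
  toPrepared := h.toPrepared.congr (h'.reg _ (by decide) (by decide))
    (h'.arr _ (by simp only [Arr.adj]; omega)) (h'.arr _ (by simp only [Arr.mult]; omega))
  marks v := by rw [h'.arr _ (by simp only [Arr.mark]; omega), h.marks v]
  card := (h'.reg _ (by decide) (by decide)).trans h.card
  base := (h'.reg _ (by decide) (by decide)).trans h.base
  pow t ht := by rw [h'.arr _ (by simp only [Arr.pow]; omega), h.pow t ht]

/-- The candidate `c` is being tried in dimension `d`, and `W` is large enough for this. -/
structure Trial (W : ℕ) (G : SimpleGraph (Fin n)) (A : Finset (Fin n)) (d c : ℕ) (s : Store) : Prop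
    extends Ready G A s where
  dim : s.reg Reg.dim = d
  cand : s.reg Reg.cand = c
  ample : Ample A.card W
  dim_le : d ≤ A.card
  cand_le : c ≤ W

/-- The current vertex is `v`, and the current dimension is `i`. -/
structure TrialAt (W : ℕ) (G : SimpleGraph (Fin n)) (A : Finset (Fin n)) (c : ℕ) (i : Fin d)
    (v : Fin n) (s : Store) : Prop extends Trial W G A d c s where
  row : s.reg Reg.row = i
  col : s.reg Reg.col = v

theorem Ample.pos {m : ℕ} (h : Ample m W) : 0 < W :=
  (Nat.succ_pos _).trans_le h.base

namespace Trial

theorem setReg (h : Trial W G A d c s) {x : ℕ} (hx : 4 < x) (v : ℕ) :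
    Trial W G A d c (s.setReg x v) where
  toReady := h.toReady.setReg (by omega) v
  dim := by rw [Store.setReg_reg, if_neg (by simp only [Reg.dim]; omega), h.dim]
  cand := by rw [Store.setReg_reg, if_neg (by simp only [Reg.cand]; omega), h.cand]
  ample := h.ample
  dim_le := h.dim_le
  cand_le := h.cand_le

theorem agree (h : Trial W G A d c s) {x : ℕ} (h' : Agree x s s') (hx : 0 < x ∧ x < 5) :
    Trial W G A d c s' where
  toReady := h.toReady.agree h' hx
  dim := (h'.reg _ (by decide) (by decide)).trans h.dim
  cand := (h'.reg _ (by decide) (by decide)).trans h.cand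
  ample := h.ample
  dim_le := h.dim_le
  cand_le := h.cand_le

theorem dim_le_trials (h : Trial W G A d c s) : d ≤ W := by
  linarith [h.dim_le, h.ample.base]

theorem quot (h : Trial W G A d c s) {t : Term} {T : ℕ}
    (hT : T ≤ (A.card + 1) * (A.card + A.card))
    (ht : ∀ j y, t.HasValue n W ((s.setReg (Reg.bound 0) j).setReg (Reg.bound 1) y) T) :
    (Term.quot t).HasValue n W s (c / (4 * A.card + 1) ^ T) := by
  rw [← sum_range_ite_mul_le c (by positivity)]
  refine .sum (.var h.cand) h.cand_le fun j hj => (Term.Decides.le (.mul (u := j + 1)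
    (.add (.var (by simp)) (.const 1)) (Nat.succ_le_of_lt (hj.trans_le h.cand_le)) fun y _ =>
      .get (ht j y) (h.pow T hT)) (.var ?_)).hasValue
  simpa using h.cand

theorem digit (h : Trial W G A d c s) {t : Term} {T : ℕ}
    (hT : T + 1 ≤ (A.card + 1) * (A.card + A.card))
    (ht : ∀ j y, t.HasValue n W ((s.setReg (Reg.bound 0) j).setReg (Reg.bound 1) y) T) :
    (Term.digit t).HasValue n W s (c / (4 * A.card + 1) ^ T % (4 * A.card + 1)) := by
  have hmod : c / (4 * A.card + 1) ^ T % (4 * A.card + 1) =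
      c / (4 * A.card + 1) ^ T - c / (4 * A.card + 1) ^ (T + 1) * (4 * A.card + 1) := by
    rw [Nat.mod_eq_sub_div_mul, Nat.div_div_eq_div_mul, pow_succ]
  rw [hmod]
  refine .sub (h.quot (Nat.le_of_succ_le hT) ht)
    (.mul (h.quot hT fun j y => (ht j y).add (.const 1))
      ((Nat.div_le_self _ _).trans h.cand_le) fun y _ => .var ?_)
  simpa using h.base

end Trial

/-- The array `k` holds the table of the values of `f`. -/
def Tabulates (k : ℕ) (f : Fin d → Fin n → ℕ) (s : Store) : Prop :=
  ∀ (i : Fin d) (v : Fin n), s.arr k (i * n + v) = f i v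

theorem rank_add_lt (hd : d ≤ A.card) (i : Fin d) (v : Fin n) :
    rank A v + i * A.card + d * A.card + 1 ≤ (A.card + 1) * (A.card + A.card) := by
  have hrank : rank A v ≤ A.card := Finset.card_filter_le _ _
  have hi : (i + 1) * A.card ≤ A.card * A.card := Nat.mul_le_mul_right _ (i.2.trans_le hd)
  have hd' : d * A.card ≤ A.card * A.card := Nat.mul_le_mul_right _ hd
  have hpos : 0 < A.card := i.pos.trans_le hd
  linarith

namespace TrialAt

theorem setReg (h : TrialAt W G A c i v s) {x : ℕ} (hx : 6 < x) (y : ℕ) :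
    TrialAt W G A c i v (s.setReg x y) where
  toTrial := h.toTrial.setReg (by omega) y
  row := by rw [Store.setReg_reg, if_neg (by simp only [Reg.row]; omega), h.row]
  col := by rw [Store.setReg_reg, if_neg (by simp only [Reg.col]; omega), h.col]

theorem row_le_trials (h : TrialAt W G A c i v s) : (i : ℕ) ≤ W :=
  i.2.le.trans h.dim_le_trials

theorem index (h : TrialAt W G A c i v s) {k : ℕ} {e : Term} {w : Fin n}
    (he : e.HasValue n W s w) : (Term.index k (.var Reg.row) e).HasValue n W s (i * n + w) :=
  .index h.size (.var h.row) h.row_le_trials he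

theorem leftPos (h : TrialAt W G A c i v s) :
    Term.leftPos.HasValue n W s (rank A v + i * A.card) := by
  have hrank : rank A v =
      ∑ w ∈ Finset.range v, if ∃ u ∈ A, (u : ℕ) = w then 1 else 0 :=
    (sum_range_ite_mem A v).symm
  rw [hrank]
  refine .add (.sum (.var h.col) v.2.le fun w hw => ?_)
    (.mul (.var h.row) h.row_le_trials fun y _ => .var (by simpa using h.card))
  refine ((h.marks.decides (v := ⟨w, hw.trans v.2⟩) (s := s.setReg _ w)
    (.var (by simp))).congr ?_).hasValue
  exact ⟨fun hw => ⟨_, hw, rfl⟩, fun ⟨u, hu, huw⟩ =>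
    (Fin.ext huw : u = ⟨w, hw.trans v.2⟩) ▸ hu⟩

theorem rightPos (h : TrialAt W G A c i v s) :
    Term.rightPos.HasValue n W s (rank A v + i * A.card + d * A.card) :=
  h.leftPos.add (.mul (.var h.dim) h.dim_le_trials fun y _ => .var (by simpa using h.card))

theorem leftDigit (h : TrialAt W G A c i v s) :
    (Term.digit .leftPos).HasValue n W s (leftDigit A c i v) :=
  h.digit ((Nat.add_le_add_right (Nat.le_add_right _ _) 1).trans (rank_add_lt h.dim_le i v))
    fun j y => ((h.setReg (by decide) j).setReg (by decide) y).leftPos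

theorem rightDigit (h : TrialAt W G A c i v s) :
    (Term.digit .rightPos).HasValue n W s (rightDigit A c i v) :=
  h.digit (rank_add_lt h.dim_le i v) fun j y =>
    ((h.setReg (by decide) j).setReg (by decide) y).rightPos

theorem markedNeighbor (h : TrialAt W G A c i v s) (w : Fin n) :
    Term.markedNeighbor.Decides n W (s.setReg (Reg.bound 2) w) (w ∈ A ∧ G.Adj v w) :=
  have h' := h.setReg (x := Reg.bound 2) (by decide) w
  have hw : (Term.var (Reg.bound 2)).HasValue n W (s.setReg (Reg.bound 2) w) w := .var (by simp)
  (h'.marks.decides hw).and (h'.decides_adj (.var h'.col) hw)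

theorem leftEnd (h : TrialAt W G A c i v s)
    (ha : Tabulates Arr.leftDigit a s) (hb : Tabulates Arr.rightDigit b s) :
    Term.leftEnd.HasValue n W s (extLeft G A (2 * A.card) (a i) (b i) v) := by
  classical
  refine Term.Decides.ite h.ample.pos (h.marks.decides (.var h.col)) (fun hv => ?_) fun hv => ?_
  · rw [extLeft_of_mem hv]
    exact .get ((h.setReg (by decide) 0).index (.var (h.setReg (by decide) 0).col)) (ha i v)
  have hsum : extLeft G A (2 * A.card) (a i) (b i) v = ∑ t ∈ Finset.range (A.card + A.card),
      if ∀ w, w ∈ A ∧ G.Adj v w → t < b i w then 1 else 0 := by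
    refine eq_of_forall_lt_iff fun t => ?_
    rw [lt_extLeft_iff hv, lt_sum_range_ite_iff fun t ht w hw => (ht w hw).le, two_mul]
    simp only [and_imp]
  rw [hsum]
  have h₀ := h.setReg (x := Reg.bound 0) (by decide) 0
  refine .sum (.add (.var h₀.card) (.var h₀.card)) (le_trans (by omega) h.ample.base) fun t _ => ?_
  have h₁ := h₀.setReg (x := Reg.bound 1) (by decide) t
  refine (Term.Decides.all (.var h₁.size) le_rfl fun w => ?_).hasValue
  exact (h₁.markedNeighbor w).imp (.lt (.var (by simp))
    (.get ((h₁.setReg (by decide) w).index (w := w) (.var (by simp))) (hb i w)))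

theorem rightEnd (h : TrialAt W G A c i v s)
    (ha : Tabulates Arr.leftDigit a s) (hb : Tabulates Arr.rightDigit b s)
    (hle : ∀ i v, a i v < 4 * A.card + 1) :
    Term.rightEnd.HasValue n W s (extRight G A (2 * A.card) (a i) (b i) v) := by
  classical
  refine Term.Decides.ite h.ample.pos (h.marks.decides (.var h.col)) (fun hv => ?_) fun hv => ?_
  · rw [extRight_of_mem hv]
    exact .get ((h.setReg (by decide) 0).index (.var (h.setReg (by decide) 0).col)) (hb i v)
  have hsum : extRight G A (2 * A.card) (a i) (b i) v = ∑ t ∈ Finset.range (4 * A.card + 1),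
      if t < A.card + A.card ∨ ∃ w, (w ∈ A ∧ G.Adj v w) ∧ t < a i w then 1 else 0 := by
    refine eq_of_forall_lt_iff fun t => ?_
    rw [lt_extRight_iff hv, lt_sum_range_ite_iff fun t ht => ht.imp (Nat.lt_of_succ_lt)
      fun ⟨w, hw, ht⟩ => ⟨w, hw, Nat.lt_of_succ_lt ht⟩, two_mul]
    simp only [and_assoc]
    refine (and_iff_right_of_imp ?_).symm
    rintro (ht | ⟨w, -, -, ht⟩)
    · linarith
    · exact ht.trans (hle i w)
  rw [hsum]
  have h₀ := h.setReg (x := Reg.bound 0) (by decide) 0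
  refine .sum (.var h₀.base) h.ample.base fun t _ => ?_
  have h₁ := h₀.setReg (x := Reg.bound 1) (by decide) t
  refine ((Term.Decides.lt (u := t) (.var (by simp)) (.add (.var h₁.card) (.var h₁.card))).or
    (.any (.var h₁.size) le_rfl fun w => ?_)).hasValue
  exact (h₁.markedNeighbor w).and (.lt (.var (by simp))
    (.get ((h₁.setReg (by decide) w).index (w := w) (.var (by simp))) (ha i w)))

end TrialAt

end Trial

section Search

variable {n W d c k : ℕ} {G : SimpleGraph (Fin n)} {A : Finset (Fin n)} {s s' : Store}
  {f : Fin d → Fin n → ℕ}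

theorem Tabulates.agree (h : Tabulates k f s) {k' : ℕ} (h' : Agree k' s s') (hk : k ≠ k') :
    Tabulates k f s' := fun i v => by
  rw [h'.arr k hk, h i v]

/-- The end points in the store form a box representation of dimension `d`. -/
def HoldsBoxModel (G : SimpleGraph (Fin n)) (d : ℕ) (s : Store) : Prop :=
  IsBoxModel G (fun (i : Fin d) v => s.arr Arr.left (i * n + v))
    fun i v => s.arr Arr.right (i * n + v)

namespace Trial

theorem tabulate_ok (h : Trial W G A d c s) (hk : 0 < k ∧ k < 5) {e : Term}
    (he : ∀ s' i v, Agree k s s' → TrialAt W G A c i v s' → e.HasValue n W s' (f i v)) :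
    (Cmd.tabulate k e).Ok n W s fun s' =>
      Trial W G A d c s' ∧ Agree k s s' ∧ Tabulates k f s' := by
  refine .mono (.grid (fun t s' => Agree k s s' ∧ ∀ (i : Fin d) (v : Fin n), i * n + v < t →
    s'.arr k (i * n + v) = f i v) (fun t s' h' => (h.agree h'.1 hk).size)
    (fun t s' i h' => ⟨h'.1.setReg (.inl rfl) i, h'.2⟩)
    (fun t s' v h' => ⟨h'.1.setReg (.inr rfl) v, h'.2⟩) (.var h.dim) h.dim_le_trials
    ⟨.refl k s, fun i v h' => absurd h' (Nat.not_lt_zero _)⟩ ?_)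
    fun s' ⟨h', ht⟩ => ⟨h.agree h' hk, h', fun i v => ht i v (index_lt i v)⟩
  rintro i v s' ⟨h', ht⟩ hrow hcol
  have hat : TrialAt W G A c i v s' := ⟨h.agree h' hk, hrow, hcol⟩
  refine .put (hat.index (.var hcol)) (he s' i v h' hat) ⟨⟨h'.setArr _ _, fun j w hlt => ?_⟩, hrow⟩
  rw [Store.setArr_arr]
  split_ifs with heq
  · obtain ⟨hij, rfl⟩ := index_inj.1 heq.2
    rw [Fin.ext hij]
  · exact ht j w (by omega)

theorem leftLeRight (h : Trial W G A d c s) {i : Fin d} (hi : s.reg (Reg.bound 2) = i)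
    {u v : Fin n} {e f : Term} (he : e.HasValue n W s u) (hf : f.HasValue n W s v) :
    (Term.leftLeRight e f).Decides n W s
      (s.arr Arr.left (i * n + u) ≤ s.arr Arr.right (i * n + v)) :=
  have hle : (i : ℕ) ≤ W := i.2.le.trans h.dim_le_trials
  .le (.get (.index h.size (.var hi) hle he) rfl) (.get (.index h.size (.var hi) hle hf) rfl)

theorem isBoxModel (h : Trial W G A d c s) :
    Term.isBoxModel.Decides n W s (HoldsBoxModel G d s) := by
  refine .all (.var h.size) le_rfl fun u => ?_
  have h₀ := h.setReg (x := Reg.bound 0) (by decide) u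
  refine .all (.var h₀.size) le_rfl fun v => ?_
  have h₁ := h₀.setReg (x := Reg.bound 1) (by decide) v
  refine .iff (.or (.congr (.eq (u := u) (v := v) (.var (by simp)) (.var (by simp))) Fin.val_inj)
    (h₁.decides_adj (.var (by simp)) (.var (by simp))))
    (.all (.var h₁.dim) h.dim_le_trials fun i => ?_)
  have h₂ := h₁.setReg (x := Reg.bound 2) (by decide) i
  exact .and (h₂.leftLeRight (i := i) (by simp) (.var (by simp)) (.var (by simp)))
    (h₂.leftLeRight (i := i) (by simp) (.var (by simp)) (.var (by simp)))

theorem tryCandidate_ok (h : Trial W G A d c s) :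
    Cmd.tryCandidate.Ok n W s fun s' => Ready G A s' ∧ s'.reg Reg.dim = d ∧
      (s'.reg Reg.found = 0 ∧ ¬ IsBoxCandidate G A d c ∨
        s'.reg Reg.found = 1 ∧ s'.reg Reg.result = d ∧ HoldsBoxModel G d s') := by
  refine .seq (h.tabulate_ok (f := leftDigit A c) (by decide) fun s' i v _ hat => hat.leftDigit)
    fun s₁ ⟨h₁, _, ha₁⟩ => .seq (h₁.tabulate_ok (f := rightDigit A c) (by decide)
    fun s' i v _ hat => hat.rightDigit) fun s₂ ⟨h₂, hag₂, hb₂⟩ => ?_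
  have ha₂ := ha₁.agree hag₂ (by decide)
  refine .seq (h₂.tabulate_ok (f := candLeft G A c) (by decide) fun s' i v hag hat =>
    hat.leftEnd (ha₂.agree hag (by decide)) (hb₂.agree hag (by decide)))
    fun s₃ ⟨h₃, hag₃, hl₃⟩ => ?_
  refine .seq (h₃.tabulate_ok (f := candRight G A c) (by decide) fun s' i v hag hat =>
    hat.rightEnd ((ha₂.agree hag₃ (by decide)).agree hag (by decide))
      ((hb₂.agree hag₃ (by decide)).agree hag (by decide)) fun i v =>
      Nat.mod_lt _ (Nat.succ_pos _)) fun s₄ ⟨h₄, hag₄, hr₄⟩ => ?_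
  have hmodel : HoldsBoxModel G d s₄ ↔ IsBoxCandidate G A d c := by
    simp only [HoldsBoxModel, IsBoxCandidate, (hl₃.agree hag₄ (by decide)) _ _, hr₄ _ _]
  classical
  refine .seq (R := fun s' => s' = _) (.set h₄.isBoxModel.hasValue rfl) ?_
  rintro _ rfl
  have h₅ := h₄.setReg (x := Reg.found) (by decide) (if HoldsBoxModel G d s₄ then 1 else 0)
  refine .set (.var h₅.dim) ⟨(h₅.setReg (by decide) d).toReady, (h₅.setReg (by decide) d).dim, ?_⟩
  by_cases hm : HoldsBoxModel G d s₄
  · exact .inr ⟨by simp [hm], by simp, hm⟩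
  · exact .inl ⟨by simp [hm], mt hmodel.2 hm⟩

end Trial

/-- The search has been successful. -/
structure Solved (G : SimpleGraph (Fin n)) (s : Store) : Prop where
  found : s.reg Reg.found = 1
  holds : HoldsBoxModel G (s.reg Reg.result) s
  minimal : ∀ d < s.reg Reg.result, ¬ HasBoxRep G d

/-- The search has been successful, or it has not, but has shown `P`. -/
def Progress (G : SimpleGraph (Fin n)) (A : Finset (Fin n)) (P : Prop) (s : Store) : Prop :=
  Ready G A s ∧ (s.reg Reg.found = 0 ∧ P ∨ Solved G s)

namespace Progress

variable {P Q : Prop}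

theorem setReg (h : Progress G A P s) {x : ℕ} (hx : 2 < x) (hx' : x < 8) (v : ℕ) :
    Progress G A P (s.setReg x v) := by
  have hreg y (hy : 8 ≤ y) : (s.setReg x v).reg y = s.reg y := by
    rw [Store.setReg_reg, if_neg (by omega)]
  refine ⟨h.1.setReg hx v, h.2.imp (fun h => ⟨(hreg _ (by decide)).trans h.1, h.2⟩) fun h => ?_⟩
  have hresult := hreg Reg.result (by decide)
  exact ⟨(hreg _ (by decide)).trans h.found, hresult ▸ h.holds, hresult ▸ h.minimal⟩

theorem imp (h : Progress G A P s) (hPQ : P → Q) : Progress G A Q s :=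
  ⟨h.1, h.2.imp_left (And.imp_right hPQ)⟩

theorem tryCandidate_ok (hW : Ample A.card W) (hd : d ≤ A.card) (hcW : c ≤ W)
    (h : Progress G A ((∀ d' < d, ¬ HasBoxRep G d') ∧ ∀ c' < c, ¬ IsBoxCandidate G A d c') s)
    (hdim : s.reg Reg.dim = d) (hcand : s.reg Reg.cand = c) :
    (Cmd.when Reg.once (.not (.var Reg.found)) Cmd.tryCandidate).Ok n W s fun s' =>
      s'.reg Reg.dim = d ∧ Progress G A
        ((∀ d' < d, ¬ HasBoxRep G d') ∧ ∀ c' < c + 1, ¬ IsBoxCandidate G A d c') s' := by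
  refine .when hW.pos (.eq_zero (.var rfl)) (fun h0 => ?_) fun h0 =>
    ⟨hdim, h.1, .inr (h.2.resolve_left fun h => h0 h.1)⟩
  obtain ⟨-, hlt, hbad⟩ := h.2.resolve_right fun h => by simp [h.found] at h0
  have htrial : Trial W G A d c s := ⟨h.1, hdim, hcand, hW, hd, hcW⟩
  refine (htrial.setReg (by decide) 0).tryCandidate_ok.mono fun s' ⟨hs', hdim', h'⟩ =>
    ⟨hdim', hs', h'.imp (fun ⟨h0', hc⟩ => ⟨h0', hlt, fun c' hc' => ?_⟩)
      fun ⟨h1, hresult, hmodel⟩ => ⟨h1, hresult ▸ hmodel, hresult ▸ hlt⟩⟩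
  rcases Nat.lt_succ_iff_lt_or_eq.1 hc' with hc' | rfl
  · exact hbad c' hc'
  · exact hc

end Progress

theorem search_ok (hs : Ready G A s) (hW : Ample A.card W) (hA : G.IsClique (A : Set (Fin n))ᶜ)
    (hfound : s.reg Reg.found = 0) : Cmd.search.Ok n W s (Solved G) := by
  refine .mono (.loop (fun d => Progress G A (∀ d' < d, ¬ HasBoxRep G d'))
    (.add (.var hs.card) (.const 1)) (le_trans (by omega) hW.base)
    ⟨hs, .inl ⟨hfound, fun d' hd' => absurd hd' d'.not_lt_zero⟩⟩ fun d hd s₁ h₁ => ?_)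
    fun s' h' => h'.2.resolve_left fun h => h.2 _ (Nat.lt_succ_self _) (hasBoxRep_card G hA)
  replace hd := Nat.le_of_lt_succ hd
  have hexp : d * (A.card + A.card) ≤ (A.card + 1) * (A.card + A.card) :=
    Nat.mul_le_mul_right _ (Nat.le_succ_of_le hd)
  have h₂ := h₁.setReg (x := Reg.dim) (by decide) (by decide) d
  refine .mono (.loop (fun c s' => s'.reg Reg.dim = d ∧ Progress G A
      ((∀ d' < d, ¬ HasBoxRep G d') ∧ ∀ c' < c, ¬ IsBoxCandidate G A d c') s')
    (.get (.mul (.var (by simp)) (by linarith [hW.base]) fun i _ =>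
      .add (.var ?_) (.var ?_)) (h₂.1.pow _ hexp)) (hW.pow _ hexp)
    ⟨by simp, h₂.imp fun h => ⟨h, fun c hc => absurd hc c.not_lt_zero⟩⟩ fun c hc s₃ h₃ => ?_)
    fun s' h' => h'.2.imp fun ⟨hlt, hbad⟩ d' hd' => ?_
  · simpa using h₂.1.card
  · simpa using h₂.1.card
  · exact (h₃.2.setReg (by decide) (by decide) c).tryCandidate_ok hW hd
      (hc.le.trans (hW.pow _ hexp)) (by simpa using h₃.1) (by simp)
  · rcases Nat.lt_succ_iff_lt_or_eq.1 hd' with hd' | rfl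
    · exact hlt d' hd'
    · intro hrep
      obtain ⟨c, hc, hc'⟩ := exists_candidate hA hrep
      exact hbad c (by rwa [mul_add]) hc'

end Search

/-! ### The running time -/

/-- A bound on the numbers of rounds that depend on the number `m` of marked vertices only. -/
def roundBound (m : ℕ) : ℕ := (4 * m + 2) ^ ((m + 1) * (m + m) + 1)

theorem ample_roundBound (m : ℕ) : Ample m (roundBound m) where
  base := le_trans (by omega) (Nat.le_self_pow (Nat.succ_ne_zero _) (4 * m + 2))
  exponent := le_trans (Nat.le_succ _) (Nat.lt_pow_self (by omega)).le
  pow _ ht := (Nat.pow_le_pow_left (by omega) _).trans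
    (Nat.pow_le_pow_right (by omega) (Nat.le_succ_of_le ht))

theorem roundBound_mono : Monotone roundBound := by
  intro m m' h
  unfold roundBound
  exact (Nat.pow_le_pow_left (by omega) _).trans (Nat.pow_le_pow_right (by omega) (by gcongr))

theorem roundBound_two_mul_le {k : ℕ} (hk : 2 ≤ k) : roundBound (2 * k) ≤ k ^ (55 * k ^ 2) := by
  have hbase : 4 * (2 * k) + 2 ≤ k ^ 5 := by
    calc 4 * (2 * k) + 2 ≤ 2 ^ 4 * k := by omega
      _ ≤ k ^ 4 * k := by gcongr
      _ = k ^ 5 := by ring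
  have hexp : (2 * k + 1) * (2 * k + 2 * k) + 1 ≤ 11 * k ^ 2 := by nlinarith
  calc roundBound (2 * k) ≤ (k ^ 5) ^ ((2 * k + 1) * (2 * k + 2 * k) + 1) :=
        Nat.pow_le_pow_left hbase _
    _ ≤ (k ^ 5) ^ (11 * k ^ 2) := Nat.pow_le_pow_right (by positivity) hexp
    _ = k ^ (55 * k ^ 2) := by rw [← pow_mul]; ring_nf

theorem natCast_pow_eq_two_rpow {k : ℕ} (hk : 0 < k) (N : ℕ) :
    (k : ℝ) ^ N = (2 : ℝ) ^ (N * Real.logb 2 k) := by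
  rw [mul_comm, Real.rpow_mul (by norm_num), Real.rpow_logb (by norm_num) (by norm_num)
    (by positivity), Real.rpow_natCast]

theorem roundBound_two_mul_le_rpow (k : ℕ) :
    (roundBound (2 * k) : ℝ) ≤
      roundBound 2 * (2 : ℝ) ^ (55 * ((k : ℝ) ^ 2 * Real.logb 2 k)) := by
  have hpos : (1 : ℝ) ≤ roundBound 2 := by exact_mod_cast (ample_roundBound 2).pos
  rcases Nat.lt_or_ge k 2 with hk | hk
  · have hlog : Real.logb 2 k = 0 := by interval_cases k <;> simp
    rw [hlog, mul_zero, mul_zero, Real.rpow_zero, mul_one]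
    exact_mod_cast roundBound_mono (by omega)
  · calc (roundBound (2 * k) : ℝ) ≤ (k : ℝ) ^ (55 * k ^ 2) := by
          exact_mod_cast roundBound_two_mul_le hk
      _ = (2 : ℝ) ^ (55 * ((k : ℝ) ^ 2 * Real.logb 2 k)) := by
          rw [natCast_pow_eq_two_rpow (by omega), ← mul_assoc]
          norm_num
      _ ≤ _ := le_mul_of_one_le_left (by positivity) hpos

theorem exists_time_bound (K D : ℕ) : ∃ C : ℕ, ∀ n m k t : ℕ, m ≤ 2 * k →
    t ≤ K * (n ^ 2 * roundBound m ^ D) →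
      (t : ℝ) ≤ C * (n : ℝ) ^ 2 * (2 : ℝ) ^ (C * (k : ℝ) ^ 2 * Real.logb 2 k) := by
  refine ⟨K * roundBound 2 ^ D + 55 * D, fun n m k t hm ht => ?_⟩
  set C := K * roundBound 2 ^ D + 55 * D
  have hlog : 0 ≤ (k : ℝ) ^ 2 * Real.logb 2 k := by
    rcases k.eq_zero_or_pos with rfl | hk
    · simp
    · exact mul_nonneg (by positivity) (Real.logb_nonneg (by norm_num) (by exact_mod_cast hk))
  have hC : (K : ℝ) * roundBound 2 ^ D ≤ C := by exact_mod_cast Nat.le_add_right _ _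
  have hC' : (55 : ℝ) * D ≤ C := by exact_mod_cast Nat.le_add_left _ _
  have hround := (Nat.cast_le.2 (roundBound_mono hm)).trans (roundBound_two_mul_le_rpow k)
  calc (t : ℝ) ≤ K * ((n : ℝ) ^ 2 * (roundBound m : ℝ) ^ D) := by exact_mod_cast ht
    _ ≤ K * ((n : ℝ) ^ 2 *
        (roundBound 2 * (2 : ℝ) ^ (55 * ((k : ℝ) ^ 2 * Real.logb 2 k))) ^ D) := by gcongr
    _ = K * roundBound 2 ^ D * (n : ℝ) ^ 2 *
        (2 : ℝ) ^ (55 * D * ((k : ℝ) ^ 2 * Real.logb 2 k)) := by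
      rw [mul_pow, ← Real.rpow_mul_natCast (by norm_num)]
      ring_nf
    _ ≤ C * (n : ℝ) ^ 2 * (2 : ℝ) ^ (C * ((k : ℝ) ^ 2 * Real.logb 2 k)) := by
      gcongr
      norm_num
    _ = _ := by rw [← mul_assoc (C : ℝ)]

theorem Solved.holdsOptimalBoxRep {n : ℕ} {G : SimpleGraph (Fin n)} {s : Store} (h : Solved G s) :
    HoldsOptimalBoxRep G (s.setReg Reg.size (s.reg Reg.result)) := by
  have hrep := isBoxRep_natCast_iff.2 h.holds
  unfold HoldsOptimalBoxRep
  rw [Store.setReg_reg, if_pos rfl]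
  exact ⟨(boxicity_eq ⟨_, _, hrep⟩ h.minimal).symm, hrep⟩

theorem box_ok {n : ℕ} (G : SimpleGraph (Fin n)) : ∃ A : Finset (Fin n), HalfFree G A ∧
    Cmd.box.Ok n (roundBound A.card) (inputStore G) (HoldsOptimalBoxRep G) := by
  have hmult W := tabulateMult_ok (W := W) (holdsGraph_inputStore G) (A := ∅)
    (fun v => by simp [inputStore]) rfl
  obtain ⟨hprep₁, hmarks₁, hfound₁⟩ := (hmult 0).2
  have hmatch {W} (hW : 0 < W) := markMatching_ok hW hprep₁ hmarks₁ hfound₁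
  -- The bound `W` has no influence on the marked set, so the latter may be used to define `W`.
  obtain ⟨A, hhalf, hclique, hprep₂, hmarks₂, hfound₂⟩ := (hmatch one_pos).2
  have hW := ample_roundBound A.card
  refine ⟨A, hhalf, .seq (R := (· = _)) ⟨(hmult _).1, rfl⟩ ?_⟩
  rintro _ rfl
  refine .seq (R := (· = _)) ⟨(hmatch hW.pos).1, rfl⟩ ?_
  rintro _ rfl
  exact .seq (countMarked_ok hprep₂ hmarks₂ hfound₂) fun s₃ ⟨hs₃, hfound₃⟩ =>
    .seq (hs₃.tabulatePow_ok hW hfound₃) fun s₄ ⟨hs₄, hfound₄⟩ =>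
      .seq (search_ok hs₄ hW hclique hfound₄) fun s₅ hs₅ => .set (.var rfl) hs₅.holdsOptimalBoxRep

theorem exists_prog_halts : ∃ (P : Prog) (C : ℕ), ∀ n : ℕ, 0 < n → ∀ G : SimpleGraph (Fin n),
    ∃ A : Finset (Fin n), HalfFree G A ∧
      P.HaltsWithin (inputStore G) (C * (n ^ 2 * roundBound A.card ^ Cmd.box.deg .trials))
        (HoldsOptimalBoxRep G) := by
  obtain ⟨K, hK⟩ := Cmd.box.isPolyBounded_bound
  refine ⟨Cmd.box.code 0, K, fun n hn G => ?_⟩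
  obtain ⟨A, hhalf, hfits, hopt⟩ := box_ok G
  have hinput : Represents 10 0 (fun _ => 0) (inputStore G) (inputStore G) :=
    ⟨rfl, fun x _ => by simp [inputStore, varReg], fun i hi => absurd hi i.not_lt_zero⟩
  refine ⟨A, hhalf, (Cmd.codeCorrect n _ _ Cmd.box_inScope hinput hfits).mono ?_ fun M' h => ?_⟩
  · simpa only [Cmd.deg_box] using hK n _ hn (ample_roundBound A.card).pos
  · unfold HoldsOptimalBoxRep at hopt ⊢
    rwa [h.arr, show M'.reg 0 = _ from h.var 0 (by norm_num)]

end Boxicity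

theorem theorem1_general :
    (∀ (V : Type*) (G : SimpleGraph V) (k : ℕ) (S : Set V), G.IsClique S → Sᶜ.encard ≤ k →
      Boxicity.boxicity G ≤ k) ∧
    ∃ (P : Boxicity.Prog) (C : ℕ), ∀ (n : ℕ), 0 < n → ∀ G : SimpleGraph (Fin n),
      ∃ (t : ℕ) (s : Boxicity.Store),
        Boxicity.Run P (Boxicity.inputStore G) t s ∧
        Boxicity.HoldsOptimalBoxRep G s ∧
        ∀ (k : ℕ) (S : Finset (Fin n)), G.IsClique (S : Set (Fin n)) → n ≤ S.card + k →
          (t : ℝ) ≤ C * (n : ℝ) ^ 2 * (2 : ℝ) ^ (C * (k : ℝ) ^ 2 * Real.logb 2 k) := by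
  refine ⟨fun V G k S => Boxicity.boxicity_le_of_isClique, ?_⟩
  obtain ⟨P, K, hP⟩ := Boxicity.exists_prog_halts
  obtain ⟨C, hC⟩ := Boxicity.exists_time_bound K (Boxicity.Cmd.box.deg .trials)
  refine ⟨P, C, fun n hn G => ?_⟩
  obtain ⟨A, hhalf, t, s, hrun, ht, hopt⟩ := hP n hn G
  exact ⟨t, s, hrun, hopt, fun k S hS hk =>
    hC n A.card k t (hhalf.card_le hS ((Fintype.card_fin n).trans_le hk)) ht⟩

theorem theorem1 :
    (∀ (V : Type*) [Fintype V] (G : SimpleGraph V) (k : ℕ) (S : Finset V),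
      G.IsClique (S : Set V) → Fintype.card V ≤ S.card + k → Boxicity.boxicity G ≤ k) ∧
    ∃ (P : Boxicity.Prog) (C : ℕ), ∀ (n : ℕ), 0 < n → ∀ G : SimpleGraph (Fin n),
      ∃ (t : ℕ) (s : Boxicity.Store),
        Boxicity.Run P (Boxicity.inputStore G) t s ∧
        Boxicity.HoldsOptimalBoxRep G s ∧
        ∀ (k : ℕ) (S : Finset (Fin n)), G.IsClique (S : Set (Fin n)) → n ≤ S.card + k →
          (t : ℝ) ≤ C * (n : ℝ) ^ 2 * (2 : ℝ) ^ (C * (k : ℝ) ^ 2 * Real.logb 2 k) := by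
  exact theorem1_general.imp_left fun h V _ G k S hS hk =>
    h V G k S hS (Boxicity.encard_compl_le hk)
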